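/- Let $B=\{\alpha,\beta\}$ be a two-letter alphabet and let $A=\{\alpha,\overline\alpha,\beta,\overline\beta\}$ be the alphabet with involution $a\leftrightarrow\overline a$ without fixed points. Let $FG(A)$ be the group generated by $A$ with defining relations $a\overline a=1$ for $a\in A$ (the free group with basis $B$), so that $B^*\subseteq A^*$ and $B^*$ embeds into $FG(A)$. A system of language equations with coefficients in $B^*$ is a finite list of equations $$L+\sum_{i\in I}u_iX_i=K+\sum_{j\in J}v_jX_j ,$$ where $L,K$ are finite subsets of $B^*$, $I,J$ are finite index sets, $u_i,v_j\in B^*$, and $X_i,X_j$ are variables (possibly repeated); $+$ denotes union. For $M\in\{B^*,A^*,FG(A)\}$, a solution over $M$ assigns to each variable a finite subset of $M$ so that all equations become identities between subsets of $M$. Two systems are sat-equivalent if one is solvable if and only if the other is. There is a polynomial-time algorithm which, on input a system $\mathcal S$ of language equations with coefficients in $B^*$, produces a system $\mathcal S'$ of exactly two language equations with the following properties. 1. $\mathcal S$ and $\mathcal S'$ are sat-equivalent (over $B^*$, and likewise over $A^*$). 2. If $\mathcal S'$ has any solution over $A^*$, then it has a solution over $B^*$ in which every variable is assigned a nonempty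 prefix-closed subset of $B^*$, and the image of this solution in $FG(A)$ is a solution of $\mathcal S'$ over $FG(A)$. 3. $\mathcal S'$ is solvable over $FG(A)$ if and only if $\mathcal S$ is solvable over $B^*$. 4. $\mathcal S'$ has the form $$L+\sum_{i\in I}u_iX_i=K+\sum_{j\in J}v_jX_j,$$ $$1+Z+\sum_{a\in B}aZ+\sum_{k\in I\cup J}X_k=1+\sum_{a\in B}aZ,$$ where $L,K\subseteq B^*$ are finite, all $u_i,v_j$ are nonempty words in $B^*$, and $Z$ is a variable with $Z\neq X_k$ for all $k\in I\cup J$. 5. Let $\sigma$ be any assignment of finite subsets of $A^*$ (respectively of $FG(A)$) to the variables which satisfies the second equation. Then $\sigma(Z)$ is a suffix-closed subset of $B^*$, the set $\{1\}\cup\bigcup_{a\in B}a\,\sigma(Z)$ is a suffix-closed subset of $B^*$, and $\sigma(X_k)$ is contained in the latter for all $k\in I\cup J$ (with $B^*$ identified with its image in $FG(A)$ in the case of $FG(A)$). -/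

import Mathlib

namespace LangEq

/-! ### Alphabets, words, free group -/

/-- The two-letter alphabet `B = {α, β}`. -/
inductive Letter
  | alpha
  | beta
  deriving DecidableEq

instance : Fintype Letter :=
  ⟨{Letter.alpha, Letter.beta}, fun x => by cases x <;> simp⟩

/-- The alphabet `A = {α, ᾱ, β, β̄}` with involution: `(b, true)` is the letter `b` of `B` and
`(b, false)` is its formal inverse. -/
abbrev SignedLetter := Letter × Bool

/-- Words over `B`. -/
abbrev BWord := FreeMonoid Letter

/-- The embedding of `B*` into `A*`. -/
def toAWord : BWord →* FreeMonoid SignedLetter :=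
  FreeMonoid.map fun b => (b, true)

/-- The canonical map from `B*` to the free group `FG(A)`, the group generated by `A` with the
relations `a ā = 1`, that is, the free group with basis `B`. -/
def toFG : BWord →* FreeGroup Letter :=
  FreeMonoid.lift FreeGroup.of

/-- `K` contains every prefix of each of its words. -/
def PrefixClosed (K : Set BWord) : Prop := ∀ u v : BWord, u * v ∈ K → u ∈ K

/-- `K` contains every suffix of each of its words. -/
def SuffixClosed (K : Set BWord) : Prop := ∀ u v : BWord, u * v ∈ K → v ∈ K

/-! ### Systems of language equations with coefficients in `B*`

Variables are named by natural numbers. -/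

/-- An expression `L + ∑ u_i X_i`: a finite set `L` of words, given by a list, and a finite family
of pairs `(u_i, X_i)` of a word and a variable (a variable may occur several times). -/
structure Side where
  consts : List BWord
  terms : List (BWord × ℕ)

/-- A language equation with one-sided concatenation. -/
structure Equation where
  lhs : Side
  rhs : Side

/-- A system of language equations. -/
abbrev LangSystem := List Equation

section Semantics

variable {M : Type} [Monoid M]

/-- The subset of `M` denoted by an expression, where words are interpreted in `M` through `φ` and
variables through `σ`. -/
def Side.value (φ : BWord →* M) (σ : ℕ → Set M) (s : Side) : Set M :=
  {m | ∃ u ∈ s.consts, m = φ u} ∪ {m | ∃ t ∈ s.terms, ∃ x ∈ σ t.2, m = φ t.1 * x}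

/-- The equation becomes an identity between subsets of `M` under `σ`. -/
def Equation.Holds (φ : BWord →* M) (σ : ℕ → Set M) (e : Equation) : Prop :=
  e.lhs.value φ σ = e.rhs.value φ σ

/-- `σ` is a solution of `S` in finite subsets of `M`. -/
def IsSolution (φ : BWord →* M) (S : LangSystem) (σ : ℕ → Set M) : Prop :=
  (∀ X, (σ X).Finite) ∧ ∀ e ∈ S, e.Holds φ σ

/-- `S` has a solution in finite subsets of `M`. -/
def Solvable (φ : BWord →* M) (S : LangSystem) : Prop :=
  ∃ σ : ℕ → Set M, IsSolution φ S σ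

end Semantics

/-- Solvability in finite subsets of the free monoid `B*`. -/
def SolvableB (S : LangSystem) : Prop := Solvable (MonoidHom.id BWord) S

/-- Solvability in finite subsets of the free monoid `A*`. -/
def SolvableA (S : LangSystem) : Prop := Solvable toAWord S

/-- Solvability in finite subsets of the free group `FG(A)`. -/
def SolvableFG (S : LangSystem) : Prop := Solvable toFG S

/-! ### The syntactic form of the output -/

/-- The equation `1 + Z + αZ + βZ + ∑_{X ∈ Xs} X = 1 + αZ + βZ`. -/
def controlEquation (Z : ℕ) (Xs : List ℕ) : Equation where
  lhs :=
    { consts := [1]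
      terms := (1, Z) :: (FreeMonoid.of Letter.alpha, Z) :: (FreeMonoid.of Letter.beta, Z) ::
        Xs.map fun X => (1, X) }
  rhs :=
    { consts := [1]
      terms := [(FreeMonoid.of Letter.alpha, Z), (FreeMonoid.of Letter.beta, Z)] }

/-- `1 + ∑_{a ∈ B} aK`. -/
def oneAddLetters (K : Set BWord) : Set BWord :=
  {w | w = 1 ∨ ∃ a : Letter, ∃ v ∈ K, w = FreeMonoid.of a * v}

/-- `σ(Z)` is (the image of) a finite suffix-closed subset `K` of `B*`, and every `σ(X)` for
`X ∈ Xs` lies in the finite suffix-closed subset `1 + ∑_{a ∈ B} aK` of `B*`. -/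
def SuffixControlled {M : Type} [Monoid M] (φ : BWord →* M) (σ : ℕ → Set M) (Z : ℕ)
    (Xs : List ℕ) : Prop :=
  ∃ K : Set BWord, K.Finite ∧ SuffixClosed K ∧ SuffixClosed (oneAddLetters K) ∧
    σ Z = φ '' K ∧ ∀ X ∈ Xs, σ X ⊆ φ '' oneAddLetters K

/-! ### Encoding of systems as words over a finite alphabet

A system is written down in the obvious way, with variables in binary; the running time of
algorithms on systems is measured in the length of this encoding. -/

/-- The tape alphabet. -/
inductive Symb
  | letter (b : Letter)
  | bit (b : Bool)
  | plus
  | dot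
  | comma
  | equals
  | semicolon
  deriving DecidableEq, Fintype

/-- A word is written letter by letter. -/
def encodeWord (u : BWord) : List Symb := u.toList.map Symb.letter

/-- A term `uX` is written as `u`, a dot, and the binary expansion of the name of `X`. -/
def encodeTerm (t : BWord × ℕ) : List Symb :=
  encodeWord t.1 ++ Symb.dot :: (Computability.encodeNat t.2).map Symb.bit

/-- The constants, each followed by a plus sign, then a comma, then the terms, each followed by a
plus sign. -/
def encodeSide (s : Side) : List Symb :=
  (s.consts.flatMap fun u => encodeWord u ++ [Symb.plus]) ++
    Symb.comma :: s.terms.flatMap fun t => encodeTerm t ++ [Symb.plus]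

/-- The two sides, separated by an equality sign. -/
def encodeEquation (e : Equation) : List Symb :=
  encodeSide e.lhs ++ Symb.equals :: encodeSide e.rhs

/-- The equations, each followed by a semicolon. -/
def encodeSystem (S : LangSystem) : List Symb :=
  S.flatMap fun e => encodeEquation e ++ [Symb.semicolon]

theorem append_sep_inj {s : Symb} {x₁ x₂ z₁ z₂ : List Symb} (h₁ : s ∉ x₁) (h₂ : s ∉ x₂)
    (h : x₁ ++ s :: z₁ = x₂ ++ s :: z₂) : x₁ = x₂ ∧ z₁ = z₂ := by
  induction x₁ generalizing x₂ with
  | nil =>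
    cases x₂ with
    | nil => exact ⟨rfl, (List.cons.inj h).2⟩
    | cons b x₂ => exact absurd (by rw [(List.cons.inj h).1]; exact List.mem_cons_self) h₂
  | cons a x₁ ih =>
    cases x₂ with
    | nil => exact absurd (by rw [← (List.cons.inj h).1]; exact List.mem_cons_self) h₁
    | cons b x₂ =>
      simp only [List.cons_append, List.cons.injEq] at h
      simp only [List.mem_cons, not_or] at h₁ h₂
      obtain ⟨h3, h4⟩ := ih h₁.2 h₂.2 h.2
      exact ⟨by rw [h.1, h3], h4⟩

theorem flatMap_sep_injective {X : Type} {f : X → List Symb} {s : Symb}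
    (hf : Function.Injective f) (hs : ∀ x, s ∉ f x) :
    Function.Injective fun l : List X => l.flatMap fun x => f x ++ [s] := by
  intro l
  induction l with
  | nil =>
    intro m h
    cases m with
    | nil => rfl
    | cons y m => simp at h
  | cons x l ih =>
    intro m h
    cases m with
    | nil => simp at h
    | cons y m =>
      simp only [List.flatMap_cons, List.append_assoc, List.singleton_append] at h
      replace h := append_sep_inj (hs _) (hs _) h
      rw [hf h.1, ih h.2]

theorem encodeWord_injective : Function.Injective encodeWord := by
  intro u v h
  exact FreeMonoid.toList.injective
    (List.map_injective_iff.2 (fun a b hab => Symb.letter.inj hab) h)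

theorem encodeTerm_injective : Function.Injective encodeTerm := by
  rintro ⟨u, X⟩ ⟨v, Y⟩ h
  simp only [encodeTerm] at h
  replace h := append_sep_inj (by simp [encodeWord]) (by simp [encodeWord]) h
  have h2 := List.map_injective_iff.2 (fun a b hab => Symb.bit.inj hab) h.2
  have h3 := congrArg Computability.decodeNat h2
  rw [Computability.decode_encodeNat, Computability.decode_encodeNat] at h3
  rw [encodeWord_injective h.1, h3]

theorem encodeSide_injective : Function.Injective encodeSide := by
  rintro ⟨c, t⟩ ⟨c', t'⟩ h
  simp only [encodeSide] at h
  replace h := append_sep_inj (by simp [encodeWord]) (by simp [encodeWord]) h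
  rw [flatMap_sep_injective encodeWord_injective (s := Symb.plus) (by simp [encodeWord]) h.1,
    flatMap_sep_injective encodeTerm_injective (s := Symb.plus)
      (by simp [encodeTerm, encodeWord]) h.2]

theorem encodeEquation_injective : Function.Injective encodeEquation := by
  rintro ⟨l, r⟩ ⟨l', r'⟩ h
  simp only [encodeEquation] at h
  replace h := append_sep_inj (by simp [encodeSide, encodeTerm, encodeWord])
    (by simp [encodeSide, encodeTerm, encodeWord]) h
  rw [encodeSide_injective h.1, encodeSide_injective h.2]

/-- Different systems have different encodings. -/
theorem encodeSystem_injective : Function.Injective encodeSystem :=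
  flatMap_sep_injective encodeEquation_injective
    (by simp [encodeEquation, encodeSide, encodeTerm, encodeWord])

/-- `f` is computed in polynomial time by a (multi-stack) Turing machine. -/
def PolyTime (f : LangSystem → LangSystem) : Prop :=
  Nonempty (Turing.TM2ComputableInPolyTime encodeSystem encodeSystem f)

end LangEq

namespace LangEq

/-! ### Words -/

/-! All equations are merged into one by prefixing the words of the `i`-th with `αⁱβ`. These tags
form a prefix code, so the merged equation falls apart into its tagged pieces again
(`merged_holds_iff`).

Prefix-closed solutions become possible because a word `w` is represented by `code w * β`, where
each letter `a` is replaced by `αa`. A proper prefix of such a word is never of this form, so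
closing a set under prefixes adds only words that represent nothing. Variable `2` occurs on both
sides of every piece and absorbs them. The piece with tag `0` states `X₂ ⊆ 1 + α + ααX₂ + αβX₂`,
which keeps coded words out of `X₂` (`code_mul_beta_notMem`). Reading off the coded words therefore
turns a solution of the output into one of the input (`solvableB_of_reduction`). Conversely, the
prefixes of the coded words, with all junk up to a large length as `X₂`, solve the output
(`exists_prefixClosed_solution`).

The second equation is an inclusion: each element of `Z` or of some `X_k` is `1` or a letter times
an element of `Z`. Unfolding an element outside `B*` would never stop and would yield infinitely
many elements of the finite set `Z` (`subset_range_of_finite`). So solutions over the group live in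
`B*` and pull back along the injection `toFG`. Over `A*` no control is needed to pull back, since
factors of words over `B` are words over `B`.

The reduction is a one-pass transduction. Coding acts letter by letter, renaming `X` to `2X + 1`
prepends one bit to the little-endian expansion, and only the tags need a counter. -/

theorem of_mul_inj {X : Type} {a b : X} {u v : FreeMonoid X} :
    FreeMonoid.of a * u = FreeMonoid.of b * v ↔ a = b ∧ u = v :=
  List.cons_eq_cons

theorem of_mul_ne_one {X : Type} (a : X) (u : FreeMonoid X) : FreeMonoid.of a * u ≠ 1 :=
  List.cons_ne_nil _ _

theorem finite_length_le (n : ℕ) : {w : BWord | w.length ≤ n}.Finite :=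
  List.finite_length_le Letter n

theorem exists_length_le {T : Set BWord} (hT : T.Finite) : ∃ n, ∀ w ∈ T, w.length ≤ n := by
  obtain ⟨n, hn⟩ := (hT.image FreeMonoid.length).bddAbove
  exact ⟨n, fun w hw => hn ⟨w, hw, rfl⟩⟩

theorem toAWord_injective : Function.Injective toAWord :=
  List.map_injective_iff.2 fun _ _ h => (Prod.mk.inj h).1

theorem toFG_eq_mk (w : BWord) : toFG w = FreeGroup.mk (w.toList.map fun b => (b, true)) := by
  induction w using FreeMonoid.inductionOn' with
  | one => rfl
  | of_mul b w ih =>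
    rw [map_mul, ih, toFG, FreeMonoid.lift_eval_of, FreeGroup.of, FreeGroup.mul_mk]
    rfl

/-- Adjacent letters of a positive word carry the same sign, so the word is reduced, and distinct
reduced words represent distinct group elements. -/
theorem toFG_injective : Function.Injective toFG := by
  intro u v h
  have hred : ∀ w : List Letter, FreeGroup.reduce (w.map fun b => (b, true)) =
      w.map fun b => (b, true) := by
    intro w
    apply FreeGroup.IsReduced.reduce_eq
    rw [FreeGroup.IsReduced, List.isChain_map]
    exact List.isChain_iff_getElem.2 fun _ _ _ => rfl
  rw [toFG_eq_mk, toFG_eq_mk] at h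
  have h' := FreeGroup.reduce.sound h
  rw [hred, hred] at h'
  exact FreeMonoid.toList.injective (List.map_injective_iff.2 (fun _ _ h => (Prod.mk.inj h).1) h')

/-- No cancellation occurs in `A*`. The analogue for `toFG` fails, as `x = u⁻¹` shows, and is
replaced there by the control equation. -/
theorem mem_range_of_toAWord_mul (u : BWord) (x : FreeMonoid SignedLetter)
    (h : toAWord u * x ∈ Set.range toAWord) : x ∈ Set.range toAWord := by
  obtain ⟨w, hw⟩ := h
  induction u using FreeMonoid.inductionOn' generalizing w with
  | one => exact ⟨w, by simpa using hw⟩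
  | of_mul b u ih =>
    induction w using FreeMonoid.inductionOn' with
    | one =>
      rw [map_mul, mul_assoc, toAWord, FreeMonoid.map_of, map_one] at hw
      exact absurd hw.symm (of_mul_ne_one _ _)
    | of_mul a w _ =>
      rw [map_mul, map_mul, mul_assoc, toAWord, FreeMonoid.map_of, FreeMonoid.map_of] at hw
      exact ih w (of_mul_inj.1 hw).2

/-! ### Transfer of solutions along a homomorphism -/

section Transfer

variable {M : Type} [Monoid M] {φ : BWord →* M}

theorem value_image (σ : ℕ → Set BWord) (s : Side) :
    s.value φ (fun X => φ '' σ X) = φ '' s.value (MonoidHom.id BWord) σ := by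
  ext m
  constructor
  · rintro (⟨u, hu, rfl⟩ | ⟨t, ht, _, ⟨x, hx, rfl⟩, rfl⟩)
    · exact ⟨u, Or.inl ⟨u, hu, rfl⟩, rfl⟩
    · exact ⟨t.1 * x, Or.inr ⟨t, ht, x, hx, rfl⟩, map_mul _ _ _⟩
  · rintro ⟨_, ⟨_, hu, rfl⟩ | ⟨t, ht, x, hx, rfl⟩, rfl⟩
    · exact Or.inl ⟨_, hu, rfl⟩
    · exact Or.inr ⟨t, ht, φ x, ⟨x, hx, rfl⟩, by simp⟩

theorem IsSolution.image {S : LangSystem} {σ : ℕ → Set BWord}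
    (h : IsSolution (MonoidHom.id BWord) S σ) : IsSolution φ S fun X => φ '' σ X := by
  refine ⟨fun X => (h.1 X).image _, fun e he => ?_⟩
  rw [Equation.Holds, value_image, value_image, h.2 e he]

/-- Hypothesis `h` excludes that a word in the range of `φ` arises from an element outside it, which
the preimage would lose. -/
theorem value_preimage (hφ : Function.Injective φ) {σ : ℕ → Set M} {s : Side}
    (h : ∀ t ∈ s.terms, ∀ x ∈ σ t.2, φ t.1 * x ∈ Set.range φ → x ∈ Set.range φ) :
    s.value (MonoidHom.id BWord) (fun X => φ ⁻¹' σ X) = φ ⁻¹' s.value φ σ := by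
  ext w
  constructor
  · rintro (⟨_, hu, rfl⟩ | ⟨t, ht, x, hx, rfl⟩)
    · exact Or.inl ⟨_, hu, rfl⟩
    · exact Or.inr ⟨t, ht, φ x, hx, map_mul _ _ _⟩
  · rintro (⟨u, hu, huw⟩ | ⟨t, ht, x, hx, hw⟩)
    · exact Or.inl ⟨u, hu, hφ huw⟩
    · obtain ⟨y, rfl⟩ := h t ht x hx ⟨w, hw⟩
      exact Or.inr ⟨t, ht, y, hx, hφ (by simpa using hw)⟩

theorem IsSolution.preimage (hφ : Function.Injective φ) {S : LangSystem} {σ : ℕ → Set M}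
    (hσ : IsSolution φ S σ)
    (h : ∀ e ∈ S, ∀ t ∈ e.lhs.terms ++ e.rhs.terms, ∀ x ∈ σ t.2,
      φ t.1 * x ∈ Set.range φ → x ∈ Set.range φ) :
    IsSolution (MonoidHom.id BWord) S fun X => φ ⁻¹' σ X := by
  refine ⟨fun X => (hσ.1 X).preimage hφ.injOn, fun e he => ?_⟩
  rw [Equation.Holds, value_preimage hφ fun t ht => h e he t (List.mem_append_left _ ht),
    value_preimage hφ fun t ht => h e he t (List.mem_append_right _ ht), hσ.2 e he]

end Transfer

theorem solvableA_iff_solvableB (S : LangSystem) : SolvableA S ↔ SolvableB S :=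
  ⟨fun ⟨_, hσ⟩ => ⟨_, hσ.preimage toAWord_injective fun _ _ _ _ _ _ =>
      mem_range_of_toAWord_mul _ _⟩,
    fun ⟨_, hσ⟩ => ⟨_, hσ.image⟩⟩

/-! ### The control equation -/

section Control

variable {M : Type} [Monoid M] {φ : BWord →* M}

/-- An element `z` outside the range never reaches `1` when unfolded, so `z = φ(wₙ) yₙ` with `|wₙ| =
n` and `yₙ ∈ T` for every `n`. By cancellation and injectivity of `φ` the `yₙ` are distinct,
contradicting finiteness. -/
theorem subset_range_of_finite (hφ : Function.Injective φ)
    (hM : ∀ a b c : M, a * c = b * c → a = b) {T : Set M} (hT : T.Finite)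
    (h : ∀ z ∈ T, z = 1 ∨ ∃ a : Letter, ∃ y ∈ T, z = φ (FreeMonoid.of a) * y) :
    T ⊆ Set.range φ := by
  intro z hz
  by_contra hzr
  have key : ∀ n : ℕ, ∃ y ∈ T, ∃ w : BWord, w.length = n ∧ z = φ w * y := by
    intro n
    induction n with
    | zero => exact ⟨z, hz, 1, rfl, by simp⟩
    | succ n ih =>
      obtain ⟨y, hy, w, hw, rfl⟩ := ih
      obtain rfl | ⟨a, x, hx, rfl⟩ := h y hy
      · exact absurd ⟨w, (mul_one _).symm⟩ hzr
      · exact ⟨x, hx, w * FreeMonoid.of a, by simp [hw], by simp [mul_assoc]⟩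
  choose y hy w hw hzw using key
  refine Set.infinite_of_injective_forall_mem (f := y) (fun i j hij => ?_) hy hT
  have := hzw i
  rw [hzw j, hij] at this
  rw [← hw i, ← hw j, hφ (hM _ _ _ this)]

theorem mem_controlEquation_rhs {σ : ℕ → Set M} {Z : ℕ} {Xs : List ℕ} {m : M} :
    m ∈ (controlEquation Z Xs).rhs.value φ σ ↔
      m = 1 ∨ ∃ a : Letter, ∃ y ∈ σ Z, m = φ (FreeMonoid.of a) * y := by
  constructor
  · rintro (⟨u, hu, rfl⟩ | ⟨t, ht, x, hx, rfl⟩)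
    · left
      simp_all [controlEquation]
    · right
      simp only [controlEquation, List.mem_cons, List.not_mem_nil, or_false] at ht
      obtain rfl | rfl := ht
      exacts [⟨_, x, hx, rfl⟩, ⟨_, x, hx, rfl⟩]
  · rintro (rfl | ⟨a, y, hy, rfl⟩)
    · exact Or.inl ⟨1, by simp [controlEquation], by simp⟩
    · exact Or.inr ⟨(FreeMonoid.of a, Z), by cases a <;> simp [controlEquation], y, hy, rfl⟩

theorem mem_controlEquation_lhs {σ : ℕ → Set M} {Z : ℕ} {Xs : List ℕ} {m : M} :
    m ∈ (controlEquation Z Xs).lhs.value φ σ ↔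
      m ∈ (controlEquation Z Xs).rhs.value φ σ ∨ m ∈ σ Z ∨ ∃ X ∈ Xs, m ∈ σ X := by
  rw [mem_controlEquation_rhs]
  constructor
  · rintro (⟨u, hu, rfl⟩ | ⟨t, ht, x, hx, rfl⟩)
    · simp_all [controlEquation]
    · simp only [controlEquation, List.mem_cons, List.mem_map] at ht
      obtain rfl | rfl | rfl | ⟨X, hX, rfl⟩ := ht
      · exact Or.inr (Or.inl (by simpa using hx))
      · exact Or.inl (Or.inr ⟨_, x, hx, rfl⟩)
      · exact Or.inl (Or.inr ⟨_, x, hx, rfl⟩)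
      · exact Or.inr (Or.inr ⟨X, hX, by simpa using hx⟩)
  · rintro ((rfl | ⟨a, y, hy, rfl⟩) | h | ⟨X, hX, h⟩)
    · exact Or.inl ⟨1, by simp [controlEquation], by simp⟩
    · exact Or.inr ⟨(FreeMonoid.of a, Z), by cases a <;> simp [controlEquation], y, hy, rfl⟩
    · exact Or.inr ⟨(1, Z), by simp [controlEquation], m, h, by simp⟩
    · exact Or.inr ⟨(1, X), by simpa [controlEquation] using Or.inr hX, m, h, by simp⟩

/-- The right side is a part of the left side, so the equation amounts to one inclusion. -/
theorem controlEquation_holds_iff {σ : ℕ → Set M} {Z : ℕ} {Xs : List ℕ} :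
    (controlEquation Z Xs).Holds φ σ ↔ ∀ m, (m ∈ σ Z ∨ ∃ X ∈ Xs, m ∈ σ X) →
      m = 1 ∨ ∃ a : Letter, ∃ y ∈ σ Z, m = φ (FreeMonoid.of a) * y := by
  simp only [Equation.Holds, Set.ext_iff, mem_controlEquation_lhs (φ := φ), or_iff_left_iff_imp]
  simp only [mem_controlEquation_rhs]

/-- A word `aw` in `Z` must be `by` with `y ∈ Z`, and uniqueness of the first letter gives `w = y ∈
Z`. Iterating, `Z` is suffix-closed. A proper suffix of a word in `1 + ∑ aZ` is `1` or lies in `Z`,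
which the equation puts back into that set. -/
theorem suffixControlled_of_holds (hφ : Function.Injective φ)
    (hM : ∀ a b c : M, a * c = b * c → a = b) {σ : ℕ → Set M} {Z : ℕ} {Xs : List ℕ}
    (hfin : (σ Z).Finite) (h : (controlEquation Z Xs).Holds φ σ) :
    SuffixControlled φ σ Z Xs := by
  rw [controlEquation_holds_iff] at h
  have hZ := subset_range_of_finite hφ hM hfin fun z hz => h z (Or.inl hz)
  have hsuf : SuffixClosed (φ ⁻¹' σ Z) := by
    intro u
    induction u using FreeMonoid.inductionOn' with
    | one => exact fun v hv => by simpa using hv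
    | of_mul a u ih =>
      intro v hv
      apply ih
      rw [mul_assoc] at hv
      obtain h1 | ⟨b, y, hy, h1⟩ := h _ (Or.inl hv)
      · exact absurd (hφ (h1.trans (map_one φ).symm)) (of_mul_ne_one _ _)
      · obtain ⟨w, rfl⟩ := hZ hy
        rw [← map_mul] at h1
        exact (of_mul_inj.1 (hφ h1)).2 ▸ hy
  refine ⟨φ ⁻¹' σ Z, hfin.preimage hφ.injOn, hsuf, ?_, ?_, ?_⟩
  · rintro u v (huv | ⟨a, w, hw, huv⟩)
    · exact Or.inl (List.append_eq_nil_iff.1 huv).2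
    · induction u using FreeMonoid.inductionOn' with
      | one => exact Or.inr ⟨a, w, hw, by simpa using huv⟩
      | of_mul b u _ =>
        rw [mul_assoc] at huv
        obtain ⟨rfl, rfl⟩ := of_mul_inj.1 huv
        have hv := hsuf u v hw
        obtain h1 | ⟨c, y, hy, h1⟩ := h _ (Or.inl hv)
        · exact Or.inl (hφ (h1.trans (map_one φ).symm))
        · obtain ⟨x, rfl⟩ := hZ hy
          exact Or.inr ⟨c, x, hy, hφ (by rw [h1, map_mul])⟩
  · exact (Set.image_preimage_eq_of_subset hZ).symm
  · intro X hX x hx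
    obtain rfl | ⟨a, y, hy, rfl⟩ := h x (Or.inr ⟨X, hX, hx⟩)
    · exact ⟨1, Or.inl rfl, map_one φ⟩
    · obtain ⟨w, rfl⟩ := hZ hy
      exact ⟨_, Or.inr ⟨a, w, hy, rfl⟩, map_mul _ _ _⟩

theorem SuffixControlled.subset_range {σ : ℕ → Set M} {Z : ℕ} {Xs : List ℕ}
    (h : SuffixControlled φ σ Z Xs) {X : ℕ} (hX : X = Z ∨ X ∈ Xs) : σ X ⊆ Set.range φ := by
  obtain ⟨K, -, -, -, hZ, hXs⟩ := h
  obtain rfl | hX := hX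
  · exact hZ ▸ Set.image_subset_range _ _
  · exact (hXs X hX).trans (Set.image_subset_range _ _)

end Control

/-- Every variable of `e` is controlled by `Z`, so all values that matter lie in the range of `φ`
and preimages lose nothing. -/
theorem solvableB_of_controlled {M : Type} [Monoid M] {φ : BWord →* M}
    (hφ : Function.Injective φ) (hM : ∀ a b c : M, a * c = b * c → a = b) {e : Equation} {Z : ℕ}
    (h : Solvable φ [e, controlEquation Z ((e.lhs.terms ++ e.rhs.terms).map Prod.snd)]) :
    SolvableB [e, controlEquation Z ((e.lhs.terms ++ e.rhs.terms).map Prod.snd)] := by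
  obtain ⟨σ, hσ⟩ := h
  have hc := suffixControlled_of_holds hφ hM (hσ.1 Z) (hσ.2 (controlEquation Z ((e.lhs.terms ++ e.rhs.terms).map Prod.snd)) (by simp))
  refine ⟨_, hσ.preimage hφ fun e' he' t ht x hx _ => hc.subset_range ?_ hx⟩
  simp only [List.mem_cons, List.not_mem_nil, or_false] at he'
  obtain rfl | rfl := he'
  · exact Or.inr (List.mem_map_of_mem ht)
  · simp only [controlEquation, List.mem_append, List.mem_cons, List.mem_map,
      List.not_mem_nil, or_false] at ht ⊢
    grind


/-! ### The reduction

A word `w` is represented by `code w * β`, the `i`-th equation is prefixed with `αⁱβ`, the variable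
`X` is renamed to `2X + 1`, the variable `2` absorbs the words which represent nothing, and `0` is
the control variable. -/

/-- The coding `a ↦ αa` of letters. -/
def code : BWord →* BWord :=
  FreeMonoid.lift fun a => FreeMonoid.of Letter.alpha * FreeMonoid.of a

/-- The word `αⁱβ`. -/
def tag (i : ℕ) : BWord :=
  FreeMonoid.ofList (List.replicate i Letter.alpha ++ [Letter.beta])

/-- The left (`false`) or right (`true`) side of an equation. -/
def Equation.side (e : Equation) (r : Bool) : Side := cond r e.rhs e.lhs

/-- The bare `tag i` is harmless, since `1` is no coded word. It is there because the machine writes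
a tag before knowing whether another constant follows. -/
def codedConsts (i : ℕ) (s : Side) : List BWord :=
  (s.consts.map fun u => tag i * (code u * FreeMonoid.of Letter.beta)) ++ [tag i]

def codedTerms (i : ℕ) (s : Side) : List (BWord × ℕ) :=
  (s.terms.map fun t => (tag i * code t.1, 2 * t.2 + 1)) ++ [(tag i, 2)]

def baseConsts : List BWord := [tag 0, tag 0 * FreeMonoid.of Letter.alpha]

/-- Only the left side contains `(tag 0, 2)`, so equality of the parts with tag `0` becomes an
inclusion for the value of variable `2`. -/
def baseTerms (r : Bool) : List (BWord × ℕ) :=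
  cond r [] [(tag 0, 2)] ++ [(tag 0 * code (FreeMonoid.of Letter.alpha), 2),
    (tag 0 * code (FreeMonoid.of Letter.beta), 2)]

/-- One side of the equation into which all equations of `S` are merged. -/
def mergedSide (S : LangSystem) (r : Bool) : Side where
  consts := baseConsts ++ ((S.zipIdx 1).flatMap fun p => codedConsts p.2 (p.1.side r)) ++
    [tag (S.length + 1)]
  terms := baseTerms r ++ (S.zipIdx 1).flatMap fun p => codedTerms p.2 (p.1.side r)

/-- The system of two equations constructed from `S`. -/
def reduction (S : LangSystem) : LangSystem :=
  [⟨mergedSide S false, mergedSide S true⟩,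
    controlEquation 0 (((mergedSide S false).terms ++ (mergedSide S true).terms).map Prod.snd)]

/-! ### Codes -/

theorem code_of_mul (a : Letter) (w : BWord) :
    code (FreeMonoid.of a * w) = FreeMonoid.of Letter.alpha * (FreeMonoid.of a * code w) := by
  rw [map_mul, code, FreeMonoid.lift_eval_of, mul_assoc]

theorem code_of (a : Letter) :
    code (FreeMonoid.of a) = FreeMonoid.of Letter.alpha * FreeMonoid.of a := by
  rw [code, FreeMonoid.lift_eval_of]

theorem tag_zero : tag 0 = FreeMonoid.of Letter.beta := rfl

theorem tag_succ (i : ℕ) : tag (i + 1) = FreeMonoid.of Letter.alpha * tag i := rfl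

theorem tag_mul_inj {i j : ℕ} {u v : BWord} (h : tag i * u = tag j * v) : i = j ∧ u = v := by
  induction i generalizing j with
  | zero =>
    cases j with
    | zero => exact ⟨rfl, mul_left_cancel h⟩
    | succ j =>
      rw [tag_zero, tag_succ, mul_assoc] at h
      exact absurd (of_mul_inj.1 h).1 (by simp)
  | succ i ih =>
    cases j with
    | zero =>
      rw [tag_zero, tag_succ, mul_assoc] at h
      exact absurd (of_mul_inj.1 h).1 (by simp)
    | succ j =>
      rw [tag_succ, tag_succ, mul_assoc, mul_assoc] at h
      obtain ⟨rfl, rfl⟩ := ih (of_mul_inj.1 h).2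
      exact ⟨rfl, rfl⟩

theorem tag_mul_ne_one (i : ℕ) (u : BWord) : tag i * u ≠ 1 := by
  cases i with
  | zero => exact of_mul_ne_one _ _
  | succ i => rw [tag_succ, mul_assoc]; exact of_mul_ne_one _ _

/-- Each block `αa` starts with `α` and the end marker is `β`, so the block structure can be read
off from the left. Hence a term `uX` yields a coded word only from a coded word in `X`. -/
theorem code_mul_beta_split {t w y : BWord}
    (h : code w * FreeMonoid.of Letter.beta = code t * y) :
    ∃ v, w = t * v ∧ y = code v * FreeMonoid.of Letter.beta := by
  induction t using FreeMonoid.inductionOn' generalizing w with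
  | one => exact ⟨w, by simp, by simpa using h.symm⟩
  | of_mul a t ih =>
    induction w using FreeMonoid.inductionOn' with
    | one =>
      rw [map_one, one_mul, code_of_mul, mul_assoc, ← mul_one (FreeMonoid.of Letter.beta)] at h
      exact absurd (of_mul_inj.1 h).1 (by simp)
    | of_mul b w _ =>
      simp only [code_of_mul, mul_assoc, of_mul_inj, true_and] at h
      obtain ⟨rfl, h⟩ := h
      obtain ⟨v, rfl, rfl⟩ := ih h
      exact ⟨v, by rw [mul_assoc], rfl⟩

theorem code_mul_beta_ne_one (w : BWord) : code w * FreeMonoid.of Letter.beta ≠ 1 :=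
  fun h => absurd (List.append_eq_nil_iff.1 h).2 (List.cons_ne_nil _ _)

theorem code_mul_beta_injective :
    Function.Injective fun w => code w * FreeMonoid.of Letter.beta := by
  intro u w h
  obtain ⟨v, rfl, hv⟩ := code_mul_beta_split (t := w) h
  induction v using FreeMonoid.inductionOn' with
  | one => simp
  | of_mul a v _ =>
    rw [code_of_mul, mul_assoc, ← mul_one (FreeMonoid.of Letter.beta)] at hv
    exact absurd (of_mul_inj.1 hv).1 (by simp)

/-- The words which extend to a word `code w * β` without being of this form. -/
def Junk : Set BWord := {y | ∃ w, y = code w ∨ y = code w * FreeMonoid.of Letter.alpha}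

theorem Junk.one : 1 ∈ Junk := ⟨1, Or.inl (map_one code).symm⟩

theorem Junk.code_mul (t : BWord) {y : BWord} (h : y ∈ Junk) : code t * y ∈ Junk := by
  obtain ⟨w, rfl | rfl⟩ := h
  · exact ⟨t * w, Or.inl (map_mul _ _ _).symm⟩
  · exact ⟨t * w, Or.inr (by rw [map_mul, mul_assoc])⟩

theorem Junk.eq_or (y : BWord) (h : y ∈ Junk) :
    y = 1 ∨ y = FreeMonoid.of Letter.alpha ∨
      ∃ a : Letter, ∃ x ∈ Junk, y = code (FreeMonoid.of a) * x := by
  obtain ⟨w, h⟩ := h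
  induction w using FreeMonoid.inductionOn' with
  | one => simpa [← or_assoc] using Or.inl h
  | of_mul a w _ =>
    simp only [map_mul, mul_assoc] at h
    obtain rfl | rfl := h
    · exact Or.inr (Or.inr ⟨a, _, ⟨w, Or.inl rfl⟩, rfl⟩)
    · exact Or.inr (Or.inr ⟨a, _, ⟨w, Or.inr rfl⟩, rfl⟩)

/-- A prefix stops between two blocks, after the `α` inside a block, or behind the end marker. -/
theorem prefix_code_mul_beta {w y z : BWord} (h : y * z = code w * FreeMonoid.of Letter.beta) :
    y ∈ Junk ∨ y = code w * FreeMonoid.of Letter.beta := by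
  induction w using FreeMonoid.inductionOn' generalizing y with
  | one =>
    induction y using FreeMonoid.inductionOn' with
    | one => exact Or.inl Junk.one
    | of_mul b y _ =>
      rw [map_one, one_mul, mul_assoc, ← mul_one (FreeMonoid.of Letter.beta), of_mul_inj] at h
      obtain ⟨rfl, h⟩ := h
      obtain rfl : y = 1 := (List.append_eq_nil_iff.1 h).1
      exact Or.inr (by simp)
  | of_mul a w ih =>
    induction y using FreeMonoid.inductionOn' with
    | one => exact Or.inl Junk.one
    | of_mul b y _ =>
      rw [mul_assoc, code_of_mul, mul_assoc, of_mul_inj] at h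
      obtain ⟨rfl, h⟩ := h
      induction y using FreeMonoid.inductionOn' with
      | one => exact Or.inl ⟨1, Or.inr (by simp)⟩
      | of_mul c y _ =>
        rw [mul_assoc, mul_assoc, of_mul_inj] at h
        obtain ⟨rfl, h⟩ := h
        obtain h | rfl := ih h
        · left
          simpa only [code_of, mul_assoc] using Junk.code_mul (FreeMonoid.of c) h
        · exact Or.inr (by simp only [code_of_mul, mul_assoc])

theorem Junk.prefixClosed : PrefixClosed Junk := by
  rintro y z ⟨w, h⟩
  -- Every junk word extends properly to a coded word: `code w` by `β`, and `code w * α` by `ββ`,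
  -- which completes the block of `β` and adds the marker.
  suffices ∃ v x, y * z * x = code v * FreeMonoid.of Letter.beta ∧ x ≠ 1 by
    obtain ⟨v, x, hx, h1⟩ := this
    rw [mul_assoc] at hx
    obtain h | rfl := prefix_code_mul_beta hx
    · exact h
    · rw [mul_eq_left] at hx
      exact absurd (List.append_eq_nil_iff.1 hx).2 h1
  obtain h | h := h
  · exact ⟨w, _, by rw [h], FreeMonoid.of_ne_one Letter.beta⟩
  · refine ⟨w * FreeMonoid.of Letter.beta, FreeMonoid.of Letter.beta * FreeMonoid.of Letter.beta,
      ?_, of_mul_ne_one _ _⟩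
    rw [h, map_mul, code_of]
    simp only [mul_assoc]

/-! ### Meaning of the merged equation -/

/-- The set denoted by the coded version of a side, without the tag. -/
def codedValue (σ : ℕ → Set BWord) (s : Side) : Set BWord :=
  {y | y = 1 ∨ y ∈ σ 2 ∨ (∃ u ∈ s.consts, y = code u * FreeMonoid.of Letter.beta) ∨
    ∃ t ∈ s.terms, ∃ x ∈ σ (2 * t.2 + 1), y = code t.1 * x}

/-- The set denoted by the right side of the equation with tag `0`, without the tag. -/
def baseValue (σ : ℕ → Set BWord) : Set BWord :=
  {y | y = 1 ∨ y = FreeMonoid.of Letter.alpha ∨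
    ∃ a : Letter, ∃ x ∈ σ 2, y = code (FreeMonoid.of a) * x}

theorem mem_mergedSide_value {σ : ℕ → Set BWord} {S : LangSystem} {r : Bool} {x : BWord} :
    x ∈ (mergedSide S r).value (MonoidHom.id BWord) σ ↔
      (∃ y, (y ∈ baseValue σ ∨ (r = false ∧ y ∈ σ 2)) ∧ x = tag 0 * y) ∨
      (∃ p ∈ S.zipIdx 1, ∃ y ∈ codedValue σ (p.1.side r), x = tag p.2 * y) ∨
      x = tag (S.length + 1) := by
  constructor
  · rintro (⟨u, hu, hx⟩ | ⟨t, ht, y, hy, hx⟩)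
    · obtain rfl : x = u := hx
      simp only [mergedSide, codedConsts, baseConsts, List.mem_append, List.mem_cons,
        List.mem_flatMap, List.not_mem_nil, or_false, List.mem_map] at hu
      obtain ((rfl | rfl) | ⟨p, hp, ⟨u, hu, rfl⟩ | rfl⟩) | rfl := hu
      · exact Or.inl ⟨1, Or.inl (Or.inl rfl), by simp⟩
      · exact Or.inl ⟨_, Or.inl (Or.inr (Or.inl rfl)), rfl⟩
      · exact Or.inr (Or.inl ⟨p, hp, _, Or.inr (Or.inr (Or.inl ⟨u, hu, rfl⟩)), rfl⟩)
      · exact Or.inr (Or.inl ⟨p, hp, 1, Or.inl rfl, by simp⟩)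
      · exact Or.inr (Or.inr rfl)
    · simp only [MonoidHom.id_apply] at hx
      subst hx
      simp only [mergedSide, codedTerms, baseTerms, List.mem_append, List.mem_cons,
        List.mem_flatMap, List.not_mem_nil, or_false, List.mem_map] at ht
      obtain (h | rfl | rfl) | ⟨p, hp, ⟨t, ht, rfl⟩ | rfl⟩ := ht
      · cases r with
        | true => simp at h
        | false =>
          simp only [cond_false, List.mem_singleton] at h
          subst h
          exact Or.inl ⟨y, Or.inr ⟨rfl, hy⟩, rfl⟩
      · exact Or.inl ⟨_, Or.inl (Or.inr (Or.inr ⟨_, y, hy, rfl⟩)), mul_assoc _ _ _⟩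
      · exact Or.inl ⟨_, Or.inl (Or.inr (Or.inr ⟨_, y, hy, rfl⟩)), mul_assoc _ _ _⟩
      · exact Or.inr (Or.inl ⟨p, hp, _, Or.inr (Or.inr (Or.inr ⟨t, ht, y, hy, rfl⟩)),
          mul_assoc _ _ _⟩)
      · exact Or.inr (Or.inl ⟨p, hp, y, Or.inr (Or.inl hy), rfl⟩)
  · rintro (⟨y, (rfl | rfl | ⟨a, x, hx, rfl⟩) | ⟨rfl, hy⟩, rfl⟩ |
      ⟨p, hp, y, rfl | hy | ⟨u, hu, rfl⟩ | ⟨t, ht, x, hx, rfl⟩, rfl⟩ | rfl)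
    · exact Or.inl ⟨tag 0, by simp [mergedSide, baseConsts], by simp⟩
    · exact Or.inl ⟨_, by simp [mergedSide, baseConsts], rfl⟩
    · refine Or.inr ⟨(tag 0 * code (FreeMonoid.of a), 2), ?_, x, hx, (mul_assoc _ _ _).symm⟩
      cases a <;> simp [mergedSide, baseTerms]
    · exact Or.inr ⟨(tag 0, 2), by simp [mergedSide, baseTerms], y, hy, rfl⟩
    · refine Or.inl ⟨tag p.2, ?_, by simp⟩
      simp only [mergedSide, List.mem_append, List.mem_flatMap]
      exact Or.inl (Or.inr ⟨p, hp, by simp [codedConsts]⟩)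
    · refine Or.inr ⟨(tag p.2, 2), ?_, y, hy, rfl⟩
      simp only [mergedSide, List.mem_append, List.mem_flatMap]
      exact Or.inr ⟨p, hp, by simp [codedTerms]⟩
    · refine Or.inl ⟨_, ?_, rfl⟩
      simp only [mergedSide, List.mem_append, List.mem_flatMap]
      exact Or.inl (Or.inr ⟨p, hp, List.mem_append_left _ (List.mem_map.2 ⟨u, hu, rfl⟩)⟩)
    · refine Or.inr ⟨(tag p.2 * code t.1, 2 * t.2 + 1), ?_, x, hx, (mul_assoc _ _ _).symm⟩
      simp only [mergedSide, List.mem_append, List.mem_flatMap]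
      exact Or.inr ⟨p, hp, List.mem_append_left _ (List.mem_map.2 ⟨t, ht, rfl⟩)⟩
    · exact Or.inl ⟨_, List.mem_append_right _ (List.mem_singleton_self _), rfl⟩

/-- Equations are numbered from `1`; tag `0` belongs to the base part and tag `S.length + 1` to the
trailing constant. A word with the tag of an equation can thus only be matched within that equation.
-/
theorem codedValue_subset_of_merged {σ : ℕ → Set BWord} {S : LangSystem} {r r' : Bool}
    (h : (mergedSide S r).value (MonoidHom.id BWord) σ ⊆
      (mergedSide S r').value (MonoidHom.id BWord) σ) {e : Equation} (he : e ∈ S) :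
    codedValue σ (e.side r) ⊆ codedValue σ (e.side r') := by
  intro y hy
  obtain ⟨i, hi, rfl⟩ := List.getElem_of_mem he
  have hmem : (S[i], i + 1) ∈ S.zipIdx 1 := by
    rw [List.mk_mem_zipIdx_iff_le_and_getElem?_sub]
    simp [hi]
  obtain ⟨z, -, hz⟩ | ⟨p, hp, z, hz, hyz⟩ | hy :=
    mem_mergedSide_value.1 (h (mem_mergedSide_value.2 (Or.inr (Or.inl ⟨_, hmem, y, hy, rfl⟩))))
  · exact absurd (tag_mul_inj hz).1 (by simp)
  · obtain ⟨hpi, rfl⟩ := tag_mul_inj hyz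
    obtain ⟨e, j⟩ := p
    obtain rfl : i + 1 = j := hpi
    rw [List.mk_mem_zipIdx_iff_le_and_getElem?_sub] at hp
    obtain rfl : S[i] = e := by simpa [hi] using hp.2
    exact hz
  · rw [← mul_one (tag (S.length + 1))] at hy
    have := (tag_mul_inj hy).1
    omega

theorem merged_holds_iff {σ : ℕ → Set BWord} {S : LangSystem} :
    Equation.Holds (MonoidHom.id BWord) σ ⟨mergedSide S false, mergedSide S true⟩ ↔
      σ 2 ⊆ baseValue σ ∧ ∀ e ∈ S, codedValue σ e.lhs = codedValue σ e.rhs := by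
  constructor
  · intro h
    replace h : (mergedSide S false).value (MonoidHom.id BWord) σ =
      (mergedSide S true).value (MonoidHom.id BWord) σ := h
    refine ⟨fun y hy => ?_, fun e he => Set.Subset.antisymm
      (codedValue_subset_of_merged h.subset he) (codedValue_subset_of_merged h.symm.subset he)⟩
    obtain ⟨z, hz, hyz⟩ | ⟨p, hp, z, -, hyz⟩ | hy := mem_mergedSide_value.1
      (h.subset (mem_mergedSide_value.2 (Or.inl ⟨y, Or.inr ⟨rfl, hy⟩, rfl⟩)))
    · rw [(tag_mul_inj hyz).2]
      simpa using hz
    · obtain ⟨e, j⟩ := p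
      rw [List.mk_mem_zipIdx_iff_le_and_getElem?_sub] at hp
      obtain rfl : 0 = j := (tag_mul_inj hyz).1
      exact absurd hp.1 (by simp)
    · rw [← mul_one (tag (_ + 1))] at hy
      exact absurd (tag_mul_inj hy).1 (by simp)
  · rintro ⟨h2, h⟩
    refine Set.ext fun x => ?_
    simp only [mem_mergedSide_value]
    refine or_congr ?_ (or_congr ?_ Iff.rfl)
    · refine exists_congr fun y => and_congr ⟨?_, Or.imp id (by simp)⟩ Iff.rfl
      rintro (hy | ⟨-, hy⟩)
      exacts [Or.inl hy, Or.inl (h2 hy)]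
    · refine exists_congr fun p => and_congr_right fun hp => ?_
      rw [show codedValue σ (p.1.side false) = codedValue σ (p.1.side true) from
        h _ (List.fst_mem_of_mem_zipIdx hp)]

/-! ### Sat-equivalence of a system and its reduction -/

/-- Neither `1` nor `α` is a coded word, and removing the first block of a coded word in `σ 2`
leaves a shorter coded word in `σ 2`, until only `β` remains. -/
theorem code_mul_beta_notMem {σ : ℕ → Set BWord} (h : σ 2 ⊆ baseValue σ) (w : BWord) :
    code w * FreeMonoid.of Letter.beta ∉ σ 2 := by
  induction w using FreeMonoid.inductionOn' with
  | one =>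
    intro hw
    rw [map_one, one_mul] at hw
    obtain h | h | ⟨a, x, -, h⟩ := h hw
    · exact FreeMonoid.of_ne_one _ h
    · exact absurd (FreeMonoid.of_injective h) (by simp)
    · rw [code_of, mul_assoc, ← mul_one (FreeMonoid.of Letter.beta)] at h
      exact absurd (of_mul_inj.1 h).1 (by simp)
  | of_mul a w ih =>
    intro hw
    obtain h | h | ⟨b, x, hx, h⟩ := h hw
    · exact code_mul_beta_ne_one _ h
    · rw [code_of_mul, mul_assoc, mul_assoc, ← mul_one (FreeMonoid.of Letter.alpha), mul_assoc,
        of_mul_inj] at h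
      simp only [one_mul] at h
      exact of_mul_ne_one _ _ h.2
    · simp only [code_of_mul, code_of, mul_assoc, of_mul_inj, true_and] at h
      obtain ⟨rfl, rfl⟩ := h
      exact ih hx

theorem solvableB_of_reduction {S : LangSystem} (h : SolvableB (reduction S)) : SolvableB S := by
  obtain ⟨σ, hfin, hσ⟩ := h
  obtain ⟨h2, hS⟩ := merged_holds_iff.1 (hσ _ List.mem_cons_self)
  -- Among the summands of `codedValue`, the constant `1` and variable `2` contribute no coded word,
  -- so the coded words represent exactly the value of `s`.
  have key : ∀ s : Side, s.value (MonoidHom.id BWord)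
      (fun X => {w | code w * FreeMonoid.of Letter.beta ∈ σ (2 * X + 1)}) =
      {w | code w * FreeMonoid.of Letter.beta ∈ codedValue σ s} := by
    intro s
    ext w
    constructor
    · rintro (⟨u, hu, rfl⟩ | ⟨t, ht, x, hx, rfl⟩)
      · exact Or.inr (Or.inr (Or.inl ⟨_, hu, rfl⟩))
      · refine Or.inr (Or.inr (Or.inr ⟨t, ht, _, hx, ?_⟩))
        simp [mul_assoc]
    · rintro (h | h | ⟨u, hu, h⟩ | ⟨t, ht, x, hx, h⟩)
      · exact absurd h (code_mul_beta_ne_one _)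
      · exact absurd h (code_mul_beta_notMem h2 w)
      · exact Or.inl ⟨u, hu, code_mul_beta_injective h⟩
      · obtain ⟨v, rfl, rfl⟩ := code_mul_beta_split h
        exact Or.inr ⟨t, ht, v, hx, rfl⟩
  refine ⟨_, fun X => (hfin (2 * X + 1)).preimage code_mul_beta_injective.injOn, fun e he => ?_⟩
  exact (key _).trans ((congrArg (fun T => {w | code w * FreeMonoid.of Letter.beta ∈ T}) (hS e he)).trans (key _).symm)

/-- The prefixes of the words which represent elements of `T`, together with the empty word. -/
def codePrefixes (T : Set BWord) : Set BWord :=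
  {y | y = 1 ∨ ∃ w ∈ T, ∃ z, y * z = code w * FreeMonoid.of Letter.beta}

theorem codePrefixes_prefixClosed (T : Set BWord) : PrefixClosed (codePrefixes T) := by
  rintro u v (h | ⟨w, hw, z, h⟩)
  · exact Or.inl (List.append_eq_nil_iff.1 h).1
  · exact Or.inr ⟨w, hw, v * z, by rw [← h, mul_assoc]⟩

theorem codePrefixes_finite {T : Set BWord} (hT : T.Finite) : (codePrefixes T).Finite := by
  obtain ⟨n, hn⟩ := exists_length_le (hT.image fun w => code w * FreeMonoid.of Letter.beta)
  refine (finite_length_le n).subset ?_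
  rintro y (rfl | ⟨w, hw, z, h⟩)
  · exact Nat.zero_le _
  · have := hn _ ⟨w, hw, rfl⟩
    simp only [← h, FreeMonoid.length_mul] at this
    exact (Nat.le_add_right _ _).trans this

/-- The assignment for the output constructed from a solution `σ` of the input. -/
def codedSolution (σ : ℕ → Set BWord) (m : ℕ) (X : ℕ) : Set BWord :=
  if X = 0 then {w | w.length ≤ m}
  else if X = 2 then {w | w ∈ Junk ∧ w.length ≤ m}
  -- For odd names, `X / 2` undoes the renaming. Other even names do not occur in the output; their
  -- value only has to be finite, nonempty and prefix-closed.
  else codePrefixes (σ (X / 2))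

theorem codedSolution_odd (σ : ℕ → Set BWord) (m X : ℕ) :
    codedSolution σ m (2 * X + 1) = codePrefixes (σ X) := by
  have : (2 * X + 1) / 2 = X := by omega
  rw [codedSolution, if_neg (by omega), if_neg (by omega), this]

theorem codedSolution_finite {σ : ℕ → Set BWord} (hσ : ∀ X, (σ X).Finite) (m X : ℕ) :
    (codedSolution σ m X).Finite := by
  unfold codedSolution
  split_ifs
  · exact finite_length_le m
  · exact (finite_length_le m).subset fun w hw => hw.2
  · exact codePrefixes_finite (hσ _)

theorem one_mem_codedSolution (σ : ℕ → Set BWord) (m X : ℕ) : 1 ∈ codedSolution σ m X := by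
  unfold codedSolution
  split_ifs
  · exact Nat.zero_le _
  · exact ⟨Junk.one, Nat.zero_le _⟩
  · exact Or.inl rfl

theorem codedSolution_prefixClosed (σ : ℕ → Set BWord) (m X : ℕ) :
    PrefixClosed (codedSolution σ m X) := by
  have hlen : ∀ u v : BWord, (u * v).length ≤ m → u.length ≤ m := fun u v h =>
    (Nat.le_add_right _ _).trans ((FreeMonoid.length_mul u v) ▸ h)
  unfold codedSolution
  split_ifs
  · exact hlen
  · exact fun u v h => ⟨Junk.prefixClosed u v h.1, hlen u v h.2⟩
  · exact codePrefixes_prefixClosed _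

theorem codedSolution_two_subset (σ : ℕ → Set BWord) (m : ℕ) :
    codedSolution σ m 2 ⊆ baseValue (codedSolution σ m) := by
  rintro y ⟨hy, hlen⟩
  obtain h | h | ⟨a, x, hx, rfl⟩ := Junk.eq_or y hy
  · exact Or.inl h
  · exact Or.inr (Or.inl h)
  · refine Or.inr (Or.inr ⟨a, x, ⟨hx, ?_⟩, rfl⟩)
    rw [FreeMonoid.length_mul] at hlen
    exact (Nat.le_add_left _ _).trans hlen

/-- Apart from the coded words of the side, only junk of length at most `m` arises, and variable `2`
supplies all such junk. The junk part is then the same for both sides of an equation. -/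
theorem codedValue_codedSolution {σ : ℕ → Set BWord} {m : ℕ} {s : Side}
    (hm : ∀ t ∈ s.terms, ∀ y ∈ codePrefixes (σ t.2), (code t.1 * y).length ≤ m) :
    codedValue (codedSolution σ m) s =
      (fun w => code w * FreeMonoid.of Letter.beta) '' s.value (MonoidHom.id BWord) σ ∪
        {w | w ∈ Junk ∧ w.length ≤ m} := by
  ext y
  constructor
  · rintro (rfl | h | ⟨u, hu, rfl⟩ | ⟨t, ht, x, hx, rfl⟩)
    · exact Or.inr ⟨Junk.one, Nat.zero_le _⟩
    · exact Or.inr h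
    · exact Or.inl ⟨u, Or.inl ⟨u, hu, rfl⟩, rfl⟩
    · rw [codedSolution_odd] at hx
      have hlen := hm t ht x hx
      obtain rfl | ⟨w, hw, z, hz⟩ := hx
      · exact Or.inr ⟨Junk.code_mul _ Junk.one, hlen⟩
      · obtain hx | rfl := prefix_code_mul_beta hz
        · exact Or.inr ⟨Junk.code_mul _ hx, hlen⟩
        · exact Or.inl ⟨t.1 * w, Or.inr ⟨t, ht, w, hw, rfl⟩, by simp [mul_assoc]⟩
  · rintro (⟨w, ⟨u, hu, h⟩ | ⟨t, ht, x, hx, h⟩, rfl⟩ | h)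
    · exact Or.inr (Or.inr (Or.inl ⟨u, hu, congrArg (fun w => code w * _) h⟩))
    · refine Or.inr (Or.inr (Or.inr ⟨t, ht, code x * FreeMonoid.of Letter.beta, ?_, ?_⟩))
      · rw [codedSolution_odd]
        exact Or.inr ⟨x, hx, 1, mul_one _⟩
      · simp [h, mul_assoc]
    · exact Or.inr (Or.inl h)

theorem exists_prefixClosed_solution {S : LangSystem} (h : SolvableB S) :
    ∃ σ : ℕ → Set BWord, IsSolution (MonoidHom.id BWord) (reduction S) σ ∧
      ∀ X, (σ X).Nonempty ∧ PrefixClosed (σ X) := by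
  obtain ⟨σ, hfin, hσ⟩ := h
  -- One length bound for everything the coded terms produce. It also bounds their arguments, which
  -- the control equation needs.
  obtain ⟨m, hm⟩ : ∃ m, ∀ e ∈ S, ∀ r, ∀ t ∈ (e.side r).terms, ∀ y ∈ codePrefixes (σ t.2),
      (code t.1 * y).length ≤ m := by
    have hT : {w | ∃ t ∈ S.flatMap fun e => (e.side false).terms ++ (e.side true).terms,
        ∃ y ∈ codePrefixes (σ t.2), code t.1 * y = w}.Finite := by
      have := (List.finite_toSet
        (S.flatMap fun e => (e.side false).terms ++ (e.side true).terms)).biUnion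
        fun t _ => (codePrefixes_finite (hfin t.2)).image fun y => code t.1 * y
      refine this.subset ?_
      rintro w ⟨t, ht, y, hy, rfl⟩
      exact Set.mem_biUnion ht ⟨y, hy, rfl⟩
    obtain ⟨m, hm⟩ := exists_length_le hT
    refine ⟨m, fun e he r t ht y hy => hm _ ⟨t, List.mem_flatMap.2 ⟨e, he, ?_⟩, y, hy, rfl⟩⟩
    cases r
    · exact List.mem_append_left _ ht
    · exact List.mem_append_right _ ht
  refine ⟨codedSolution σ m, ⟨codedSolution_finite hfin m, fun e he => ?_⟩, fun X =>
    ⟨⟨1, one_mem_codedSolution σ m X⟩, codedSolution_prefixClosed σ m X⟩⟩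
  simp only [reduction, List.mem_cons, List.not_mem_nil, or_false] at he
  obtain rfl | rfl := he
  · refine merged_holds_iff.2 ⟨codedSolution_two_subset σ m, fun e he => ?_⟩
    have hl := codedValue_codedSolution (hm e he false)
    rw [show (e.side false).value (MonoidHom.id BWord) σ = (e.side true).value (MonoidHom.id BWord) σ
      from hσ e he] at hl
    exact hl.trans (codedValue_codedSolution (hm e he true)).symm
  · have hlen : ∀ w : BWord, w.length ≤ m →
        w = 1 ∨ ∃ a : Letter, ∃ y ∈ codedSolution σ m 0, w = FreeMonoid.of a * y := by
      intro w hw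
      induction w using FreeMonoid.inductionOn' with
      | one => exact Or.inl rfl
      | of_mul a w _ =>
        rw [FreeMonoid.length_mul] at hw
        exact Or.inr ⟨a, w, (Nat.le_add_left _ _).trans hw, rfl⟩
    rw [controlEquation_holds_iff]
    rintro w (hw | ⟨X, hX, hw⟩)
    · exact hlen w hw
    · apply hlen
      obtain ⟨r, t, ht, rfl⟩ : ∃ r, ∃ t ∈ (mergedSide S r).terms, t.2 = X := by
        obtain ⟨t, ht, rfl⟩ := List.mem_map.1 hX
        obtain ht | ht := List.mem_append.1 ht
        exacts [⟨_, t, ht, rfl⟩, ⟨_, t, ht, rfl⟩]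
      simp only [mergedSide, codedTerms, List.mem_append, List.mem_cons,
        List.mem_flatMap, List.not_mem_nil, or_false, List.mem_map] at ht
      obtain ht | ⟨p, hp, ⟨t, ht, rfl⟩ | rfl⟩ := ht
      · have ht2 : t.2 = 2 := by
          cases r <;> simp only [baseTerms, cond_true, cond_false, List.mem_append, List.mem_cons,
            List.not_mem_nil, or_false, false_or] at ht <;> grind
        rw [ht2] at hw
        exact hw.2
      · rw [codedSolution_odd] at hw
        have := hm _ (List.fst_mem_of_mem_zipIdx hp) r t ht w hw
        rw [FreeMonoid.length_mul] at this
        exact (Nat.le_add_left _ _).trans this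
      · exact hw.2

theorem solvableB_reduction_iff (S : LangSystem) : SolvableB S ↔ SolvableB (reduction S) :=
  ⟨fun h => (exists_prefixClosed_solution h).imp fun _ h => h.1, solvableB_of_reduction⟩

theorem mergedSide_terms {S : LangSystem} {r : Bool} {t : BWord × ℕ}
    (ht : t ∈ (mergedSide S r).terms) : t.1 ≠ 1 ∧ t.2 ≠ 0 := by
  have htag : ∀ i, tag i ≠ 1 := fun i => mul_one (tag i) ▸ tag_mul_ne_one i 1
  simp only [mergedSide, codedTerms, baseTerms, List.mem_append, List.mem_cons,
    List.mem_flatMap, List.not_mem_nil, or_false, List.mem_map] at ht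
  obtain (h | rfl | rfl) | ⟨p, hp, ⟨t, ht, rfl⟩ | rfl⟩ := ht
  · cases r with
    | true => simp at h
    | false =>
      simp only [cond_false, List.mem_singleton] at h
      subst h
      exact ⟨htag 0, by simp⟩
  · exact ⟨tag_mul_ne_one _ _, by simp⟩
  · exact ⟨tag_mul_ne_one _ _, by simp⟩
  · exact ⟨tag_mul_ne_one _ _, by simp⟩
  · exact ⟨htag _, by simp⟩


open Turing

/-! ### Space used by a machine with store -/

section Space

variable {K : Type} [DecidableEq K] [Fintype K] {Γ : K → Type} {Λ σ : Type}

def stackSpace (S : ∀ k, List (Γ k)) : ℕ := ∑ k, (S k).length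

theorem stackSpace_update (S : ∀ k, List (Γ k)) (k : K) (x : List (Γ k)) :
    stackSpace (Function.update S k x) + (S k).length = stackSpace S + x.length := by
  unfold stackSpace
  rw [← Finset.add_sum_erase _ _ (Finset.mem_univ k),
    ← Finset.add_sum_erase _ (fun k => (S k).length) (Finset.mem_univ k), Function.update_self,
    Finset.sum_congr rfl fun j hj => by rw [Function.update_of_ne (Finset.ne_of_mem_erase hj)]]
  omega

/-- A bound on the number of push operations in one run of a statement. -/
def pushCount : TM2.Stmt Γ Λ σ → ℕ
  | .push _ _ q => pushCount q + 1
  | .peek _ _ q => pushCount q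
  | .pop _ _ q => pushCount q
  | .load _ q => pushCount q
  | .branch _ q₁ q₂ => max (pushCount q₁) (pushCount q₂)
  | .goto _ => 0
  | .halt => 0

theorem stackSpace_stepAux (q : TM2.Stmt Γ Λ σ) (v : σ) (S : ∀ k, List (Γ k)) :
    stackSpace (TM2.stepAux q v S).stk ≤ stackSpace S + pushCount q := by
  induction q generalizing v S with
  | push k f q ih =>
    have h := ih v (Function.update S k (f v :: S k))
    have h' := stackSpace_update S k (f v :: S k)
    simp only [TM2.stepAux, pushCount, List.length_cons] at *
    omega
  | peek k f q ih => exact ih _ _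
  | pop k f q ih =>
    have h := ih (f v (S k).head?) (Function.update S k (S k).tail)
    have h' := stackSpace_update S k (S k).tail
    simp only [TM2.stepAux, pushCount, List.length_tail] at *
    omega
  | load a q ih => exact ih _ _
  | branch f q₁ q₂ ih₁ ih₂ =>
    rw [TM2.stepAux, pushCount]
    cases f v
    · exact (ih₂ _ _).trans (by simp)
    · exact (ih₁ _ _).trans (by simp)
  | goto f => exact le_rfl
  | halt => exact le_rfl

/-- The space grows by at most `d` per step. This bounds the buffers, and hence the time to empty
them, without computing the length of the output. -/
theorem stackSpace_iterate {M : Λ → TM2.Stmt Γ Λ σ} {d : ℕ} (hd : ∀ l, pushCount (M l) ≤ d)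
    {n : ℕ} {c c' : TM2.Cfg Γ Λ σ} (h : (flip bind (TM2.step M))^[n] (some c) = some c') :
    stackSpace c'.stk ≤ stackSpace c.stk + n * d := by
  induction n generalizing c' with
  | zero =>
    obtain rfl : c = c' := Option.some.inj h
    simp
  | succ n ih =>
    rw [Function.iterate_succ_apply'] at h
    obtain ⟨⟨l, v, S⟩, hc, h1⟩ := Option.bind_eq_some_iff.1 h
    have h2 := ih hc
    cases l with
    | none => simp at h1
    | some l =>
      simp only [TM2.step, Option.some.injEq] at h1
      subst h1
      have h3 := stackSpace_stepAux (M l) v S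
      have h4 := hd l
      simp only at h2
      linarith [add_mul n 1 d]

end Space

/-! ### The machine -/

/-- The buffers in which the parts of the output are collected: the constants and the terms of the
two sides of the merged equation, and the variables of these terms. -/
inductive Buf
  | consts (r : Bool)
  | terms (r : Bool)
  | names (r : Bool)
  deriving DecidableEq, Fintype

inductive Stk
  | input
  | output
  | counter
  | spare
  | buf (b : Buf)
  deriving DecidableEq, Fintype

/-- The labels of the program. In the parameters, `t` tells whether the constants (`false`) or the
terms (`true`) of a side are being read, and `r` tells which side. -/
inductive Lbl
  | start
  | read (t r : Bool)
  | handle (t r : Bool) (s : Symb)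
  | mark (t r : Bool)
  | unmark (t r : Bool)
  | finish
  | drain (b : Buf)
  deriving DecidableEq, Fintype

/-- The buffer to which words are written. -/
def wordBuf (t r : Bool) : Buf := cond t (Buf.terms r) (Buf.consts r)

abbrev Code := TM2.Stmt (fun _ : Stk => Symb) Lbl (Option Symb)

def pushes (k : Stk) (w : List Symb) (q : Code) : Code :=
  w.foldr (fun s q => .push k (fun _ => s) q) q

/-- The part of the encoded term `uX` after the word `u`. -/
def encodeName (X : ℕ) : List Symb := Symb.dot :: (Computability.encodeNat X).map Symb.bit

def encodeConsts (l : List BWord) : List Symb := l.flatMap fun u => encodeWord u ++ [Symb.plus]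

def encodeTerms (l : List (BWord × ℕ)) : List Symb :=
  l.flatMap fun t => encodeTerm t ++ [Symb.plus]

def encodeNames (l : List (BWord × ℕ)) : List Symb :=
  l.flatMap fun t => encodeName t.2 ++ [Symb.plus]

/-- The encoding of the control equation up to the terms `X`. -/
def controlPrefix : List Symb :=
  Symb.plus :: Symb.comma :: encodeTerms [(1, 0), (FreeMonoid.of Letter.alpha, 0),
    (FreeMonoid.of Letter.beta, 0)]

/-- The encoding of the control equation after the terms `X`. -/
def controlSuffix : List Symb :=
  Symb.equals :: Symb.plus :: Symb.comma :: encodeTerms [(FreeMonoid.of Letter.alpha, 0),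
    (FreeMonoid.of Letter.beta, 0)] ++ [Symb.semicolon]

def one : Symb := Symb.letter Letter.alpha

/-- The bit `true` pushed after a dot turns `X` into `2X + 1`, as binary expansions start with the
least significant bit. The `names` buffer receives the terms without their words, that is, the terms
`1X` of the control equation. The final case does not arise on encoded systems. -/
def handleCode : Bool → Bool → Symb → Code
  | t, r, .letter a => pushes (.buf (wordBuf t r)) [one, .letter a] (.goto fun _ => .read t r)
  | false, r, .plus => pushes (.buf (.consts r)) [.letter Letter.beta, .plus]
      (.goto fun _ => .mark false r)
  | false, r, .comma => pushes (.buf (.consts r)) [.plus] (.goto fun _ => .mark true r)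
  | true, r, .dot => pushes (.buf (.terms r)) [.dot, .bit true]
      (pushes (.buf (.names r)) [.dot, .bit true] (.goto fun _ => .read true r))
  | true, r, .bit b => pushes (.buf (.terms r)) [.bit b]
      (pushes (.buf (.names r)) [.bit b] (.goto fun _ => .read true r))
  | true, r, .plus => pushes (.buf (.terms r)) [.plus]
      (pushes (.buf (.names r)) [.plus] (.goto fun _ => .mark true r))
  | true, r, .equals => pushes (.buf (.terms r)) (encodeName 2 ++ [.plus])
      (pushes (.buf (.names r)) (encodeName 2 ++ [.plus]) (.goto fun _ => .mark false true))
  | true, r, .semicolon => pushes (.buf (.terms r)) (encodeName 2 ++ [.plus])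
      (pushes (.buf (.names r)) (encodeName 2 ++ [.plus])
        (pushes .counter [one] (.goto fun _ => .mark false false)))
  | _, _, _ => .halt

/-- What follows after the buffer `b` has been written to the output. -/
def drained : Buf → Code
  | .names true => .goto fun _ => .drain (.names false)
  | .names false => pushes .output (Symb.semicolon :: controlPrefix).reverse
      (.goto fun _ => .drain (.terms true))
  | .terms true => pushes .output [.comma] (.goto fun _ => .drain (.consts true))
  | .consts true => pushes .output [.equals] (.goto fun _ => .drain (.terms false))
  | .terms false => pushes .output [.comma] (.goto fun _ => .drain (.consts false))
  | .consts false => .halt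

/-- Copying a tag moves the counter to the spare stack (`mark`), and `unmark` moves it back. The
output stack is filled from the end of the output: draining a buffer pops its last symbol first, so
its content reappears in the right order, and the buffers are drained last part first. -/
def program : Lbl → Code
  | .start =>
      pushes (.buf (.consts false)) (encodeConsts baseConsts) <|
      pushes (.buf (.consts true)) (encodeConsts baseConsts) <|
      pushes (.buf (.terms false)) (encodeTerms (baseTerms false)) <|
      pushes (.buf (.terms true)) (encodeTerms (baseTerms true)) <|
      pushes (.buf (.names false)) (encodeNames (baseTerms false)) <|
      pushes (.buf (.names true)) (encodeNames (baseTerms true)) <|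
      pushes .counter [one] (.goto fun _ => .mark false false)
  | .read t r => .pop .input (fun _ s => s) <|
      .goto fun v => v.elim .finish (.handle t r)
  | .handle t r s => handleCode t r s
  | .mark t r => .pop .counter (fun _ s => s) <| .branch Option.isSome
      (pushes .spare [one] (pushes (.buf (wordBuf t r)) [one] (.goto fun _ => .mark t r)))
      (pushes (.buf (wordBuf t r)) [.letter Letter.beta] (.goto fun _ => .unmark t r))
  | .unmark t r => .pop .spare (fun _ s => s) <| .branch Option.isSome
      (pushes .counter [one] (.goto fun _ => .unmark t r))
      (.goto fun _ => .read t r)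
  | .finish => .pop .counter (fun _ s => s) <| .branch Option.isSome
      (pushes (.buf (.consts true)) [one] (.goto fun _ => .finish))
      (pushes (.buf (.consts true)) [.letter Letter.beta, .plus] <|
        pushes (.buf (.consts false)) [.plus] <|
        pushes .output controlSuffix.reverse (.goto fun _ => .drain (.names true)))
  | .drain b => .pop (.buf b) (fun _ s => s) <| .branch Option.isSome
      (.push .output (fun v => v.getD .plus) (.goto fun _ => .drain b))
      (drained b)

/-! ### Runs of the machine -/

/-- The store, where a buffer is listed from the bottom to the top. -/
def store (i o c s : List Symb) (O : Buf → List Symb) : Stk → List Symb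
  | .input => i
  | .output => o
  | .counter => c
  | .spare => s
  | .buf b => (O b).reverse

section Stacks

variable {i o c s x : List Symb} {O : Buf → List Symb} {b b' : Buf}

@[simp]
theorem update_store_input :
    Function.update (store i o c s O) .input x = store x o c s O := by
  funext k; cases k <;> simp [store, Function.update]

@[simp]
theorem update_store_output :
    Function.update (store i o c s O) .output x = store i x c s O := by
  funext k; cases k <;> simp [store, Function.update]

@[simp]
theorem update_store_counter :
    Function.update (store i o c s O) .counter x = store i o x s O := by
  funext k; cases k <;> simp [store, Function.update]

@[simp]
theorem update_store_spare :
    Function.update (store i o c s O) .spare x = store i o c x O := by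
  funext k; cases k <;> simp [store, Function.update]

@[simp]
theorem update_store_buf :
    Function.update (store i o c s O) (.buf b) x =
      store i o c s (Function.update O b x.reverse) := by
  funext k
  cases k with
  | buf b' =>
    by_cases h : b' = b
    · subst h; simp [store]
    · simp [store, Function.update, h]
  | _ => simp [store, Function.update]

/-- Append a word to a buffer. -/
def put (O : Buf → List Symb) (b : Buf) (w : List Symb) : Buf → List Symb :=
  fun b' => if b' = b then O b' ++ w else O b'

theorem put_put (w w' : List Symb) : put (put O b w) b w' = put O b (w ++ w') := by
  funext b'
  by_cases h : b' = b <;> simp [put, h]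

theorem put_comm (h : b ≠ b') (w w' : List Symb) :
    put (put O b w) b' w' = put (put O b' w') b w := by
  funext b''
  by_cases h1 : b'' = b <;> by_cases h2 : b'' = b' <;> simp_all [put]

theorem update_eq_put (w : List Symb) : Function.update O b (O b ++ w) = put O b w := by
  funext b'
  by_cases h : b' = b
  · subst h; simp [put]
  · simp [put, h]

theorem stepAux_pushes (k : Stk) (w : List Symb) (q : Code) (v : Option Symb)
    (S : Stk → List Symb) :
    TM2.stepAux (pushes k w q) v S =
      TM2.stepAux q v (Function.update S k (w.reverse ++ S k)) := by
  induction w generalizing S with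
  | nil => simp [pushes]
  | cons a w ih =>
    have := ih (Function.update S k (a :: S k))
    simp only [pushes, List.foldr_cons, TM2.stepAux] at this ⊢
    rw [this]
    simp

@[simp]
theorem stepAux_pushes_buf (w : List Symb) (q : Code) (v : Option Symb) :
    TM2.stepAux (pushes (.buf b) w q) v (store i o c s O) =
      TM2.stepAux q v (store i o c s (put O b w)) := by
  rw [stepAux_pushes, update_store_buf, ← update_eq_put]
  simp [store]

@[simp]
theorem stepAux_pushes_counter (w : List Symb) (q : Code) (v : Option Symb) :
    TM2.stepAux (pushes .counter w q) v (store i o c s O) =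
      TM2.stepAux q v (store i o (w.reverse ++ c) s O) := by
  rw [stepAux_pushes, update_store_counter]
  rfl

@[simp]
theorem stepAux_pushes_spare (w : List Symb) (q : Code) (v : Option Symb) :
    TM2.stepAux (pushes .spare w q) v (store i o c s O) =
      TM2.stepAux q v (store i o c (w.reverse ++ s) O) := by
  rw [stepAux_pushes, update_store_spare]
  rfl

@[simp]
theorem stepAux_pushes_output (w : List Symb) (q : Code) (v : Option Symb) :
    TM2.stepAux (pushes .output w q) v (store i o c s O) =
      TM2.stepAux q v (store i (w.reverse ++ o) c s O) := by
  rw [stepAux_pushes, update_store_output]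
  rfl

end Stacks

/-- Within `n` steps the machine gets from label `l` and store `S` to label `l'` and store
`S'`. -/
def Runs (n : ℕ) (l : Lbl) (S : Stk → List Symb) (l' : Lbl) (S' : Stk → List Symb) : Prop :=
  ∀ v, ∃ k ≤ n, ∃ v', (flip bind (TM2.step program))^[k] (some ⟨some l, v, S⟩) =
    some ⟨some l', v', S'⟩

theorem Runs.refl (n : ℕ) (l : Lbl) (S : Stk → List Symb) : Runs n l S l S :=
  fun v => ⟨0, Nat.zero_le _, v, rfl⟩

theorem Runs.trans {m n : ℕ} {l₁ l₂ l₃ : Lbl} {S₁ S₂ S₃ : Stk → List Symb}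
    (h₁ : Runs m l₁ S₁ l₂ S₂) (h₂ : Runs n l₂ S₂ l₃ S₃) : Runs (m + n) l₁ S₁ l₃ S₃ := by
  intro v
  obtain ⟨j, hj, v', hv'⟩ := h₁ v
  obtain ⟨k, hk, v'', hv''⟩ := h₂ v'
  refine ⟨k + j, by omega, v'', ?_⟩
  rw [Function.iterate_add_apply, hv', hv'']

theorem Runs.congr {m n : ℕ} {l l' : Lbl} {S S' T : Stk → List Symb} (h : Runs m l S l' S')
    (hn : m ≤ n) (hT : S' = T) : Runs n l S l' T := by
  subst hT
  intro v
  obtain ⟨k, hk, h⟩ := h v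
  exact ⟨k, hk.trans hn, h⟩

theorem Runs.of_step {l l' : Lbl} {S S' : Stk → List Symb}
    (h : ∀ v, ∃ v', TM2.stepAux (program l) v S = ⟨some l', v', S'⟩) : Runs 1 l S l' S' := by
  intro v
  obtain ⟨v', hv'⟩ := h v
  exact ⟨1, le_rfl, v', congrArg some hv'⟩

/-! ### Effect and running time of the phases of the machine -/

section Phases

variable {i o c s : List Symb} {O : Buf → List Symb} {t r : Bool}

theorem runs_read (a : Symb) :
    Runs 1 (.read t r) (store (a :: i) o c s O) (.handle t r a) (store i o c s O) :=
  Runs.of_step fun _ => ⟨some a, by simp [program, store]⟩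

theorem runs_unmark (k e : ℕ) :
    Runs (e + 1) (.unmark t r) (store i o (List.replicate k one) (List.replicate e one) O)
      (.read t r) (store i o (List.replicate (e + k) one) [] O) := by
  induction e generalizing k with
  | zero => exact Runs.of_step fun _ => ⟨none, by simp [program, store]⟩
  | succ e ih =>
    have h : Runs 1 (.unmark t r)
        (store i o (List.replicate k one) (List.replicate (e + 1) one) O) (.unmark t r)
        (store i o (List.replicate (k + 1) one) (List.replicate e one) O) :=
      Runs.of_step fun _ => ⟨some one, by simp [program, store, List.replicate_succ]⟩
    exact (h.trans (ih (k + 1))).congr (by omega) (by rw [Nat.add_right_comm, Nat.add_assoc])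

theorem runs_mark_unmark (k e : ℕ) :
    Runs (e + 1) (.mark t r) (store i o (List.replicate e one) (List.replicate k one) O)
      (.unmark t r) (store i o [] (List.replicate (e + k) one)
        (put O (wordBuf t r) (encodeWord (tag e)))) := by
  induction e generalizing k O with
  | zero =>
    exact Runs.of_step fun _ => ⟨none, by simp [program, store, encodeWord, tag]⟩
  | succ e ih =>
    have h : Runs 1 (.mark t r)
        (store i o (List.replicate (e + 1) one) (List.replicate k one) O) (.mark t r)
        (store i o (List.replicate e one) (List.replicate (k + 1) one)
          (put O (wordBuf t r) [one])) :=
      Runs.of_step fun _ => ⟨some one, by simp [program, store, List.replicate_succ]⟩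
    refine (h.trans (ih (k + 1))).congr (by omega) ?_
    rw [put_put, Nat.add_right_comm, Nat.add_assoc]
    rfl

/-- The tag is copied to the buffer. -/
theorem runs_mark (e : ℕ) :
    Runs (2 * e + 2) (.mark t r) (store i o (List.replicate e one) [] O)
      (.read t r) (store i o (List.replicate e one) []
        (put O (wordBuf t r) (encodeWord (tag e)))) :=
  ((runs_mark_unmark 0 e).trans (runs_unmark 0 e)).congr (by omega) rfl

theorem encodeWord_mul (u v : BWord) : encodeWord (u * v) = encodeWord u ++ encodeWord v := by
  simp [encodeWord]

theorem encodeWord_of (a : Letter) : encodeWord (FreeMonoid.of a) = [Symb.letter a] := rfl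

theorem encodeWord_one : encodeWord 1 = [] := rfl

theorem put_nil (b : Buf) : put O b [] = O := by
  funext b'
  simp [put]

theorem runs_word (u : BWord) :
    Runs (2 * (encodeWord u).length) (.read t r) (store (encodeWord u ++ i) o c s O)
      (.read t r) (store i o c s (put O (wordBuf t r) (encodeWord (code u)))) := by
  induction u using FreeMonoid.inductionOn' generalizing O with
  | one => exact (Runs.refl _ _ _).congr le_rfl (by rw [map_one, encodeWord_one, put_nil]; rfl)
  | of_mul a u ih =>
    rw [code_of_mul]
    simp only [encodeWord_mul, encodeWord_of]
    have h : Runs 1 (.handle t r (.letter a)) (store (encodeWord u ++ i) o c s O) (.read t r)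
        (store (encodeWord u ++ i) o c s (put O (wordBuf t r) [one, .letter a])) :=
      Runs.of_step fun v => ⟨v, by simp [program, handleCode]⟩
    refine ((runs_read _).trans (h.trans ih)).congr (by simp; omega) ?_
    rw [put_put]
    rfl

theorem runs_bits (l : List Bool) :
    Runs (2 * l.length) (.read true r) (store (l.map Symb.bit ++ i) o c s O)
      (.read true r) (store i o c s
        (put (put O (.terms r) (l.map Symb.bit)) (.names r) (l.map Symb.bit))) := by
  induction l generalizing O with
  | nil => exact (Runs.refl _ _ _).congr le_rfl (by rw [List.map_nil, put_nil, put_nil]; rfl)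
  | cons a l ih =>
    have h : Runs 1 (.handle true r (.bit a)) (store (l.map Symb.bit ++ i) o c s O)
        (.read true r) (store (l.map Symb.bit ++ i) o c s
          (put (put O (.terms r) [.bit a]) (.names r) [.bit a])) :=
      Runs.of_step fun v => ⟨v, by simp [program, handleCode]⟩
    refine ((runs_read _).trans (h.trans ih)).congr (by simp; omega) ?_
    rw [put_comm (b := .names r) (b' := .terms r) (by simp), put_put, put_put]
    rfl

theorem encodeNat_two_mul_add_one (X : ℕ) :
    Computability.encodeNat (2 * X + 1) = true :: Computability.encodeNat X := by
  have h : ((2 * X + 1 : ℕ) : Num) = Num.bit1 X := by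
    rw [← Num.ofNat'_eq, ← Num.ofNat'_eq]
    exact Num.ofNat'_bit true X
  unfold Computability.encodeNat
  rw [h]
  cases (X : Num) <;> rfl

/-- Invariant: the tag of the next item is already in the buffer. At the comma the pending tag is
closed as the bare constant. The cost of copying a tag is charged to the separator just read. -/
theorem runs_consts (B e : ℕ) (he : e ≤ B) (l : List BWord) :
    Runs ((2 * B + 4) * (encodeConsts l ++ [Symb.comma]).length) (.read false r)
      (store (encodeConsts l ++ Symb.comma :: i) o (List.replicate e one) []
        (put O (.consts r) (encodeWord (tag e))))
      (.read true r) (store i o (List.replicate e one) []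
        (put (put O (.consts r) (encodeConsts
          ((l.map fun u => tag e * (code u * FreeMonoid.of Letter.beta)) ++ [tag e])))
          (.terms r) (encodeWord (tag e)))) := by
  induction l generalizing O with
  | nil =>
    have h : Runs 1 (.handle false r .comma) (store i o (List.replicate e one) []
        (put O (.consts r) (encodeWord (tag e)))) (.mark true r)
        (store i o (List.replicate e one) []
          (put O (.consts r) (encodeWord (tag e) ++ [.plus]))) :=
      Runs.of_step fun v => ⟨v, by simp [program, handleCode, put_put]⟩
    refine ((runs_read _).trans (h.trans (runs_mark e))).congr ?_ ?_
    · simp [encodeConsts]; omega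
    · simp [encodeConsts, wordBuf]
  | cons u l ih =>
    have h : Runs 1 (.handle false r .plus)
        (store (encodeConsts l ++ Symb.comma :: i) o (List.replicate e one) []
          (put (put O (.consts r) (encodeWord (tag e))) (.consts r) (encodeWord (code u))))
        (.mark false r) (store (encodeConsts l ++ Symb.comma :: i) o (List.replicate e one) []
          (put O (.consts r)
            (encodeWord (tag e * (code u * FreeMonoid.of Letter.beta)) ++ [.plus]))) :=
      Runs.of_step fun v => ⟨v, by
        simp [program, handleCode, put_put, encodeWord_mul, encodeWord_of]⟩
    rw [show encodeConsts (u :: l) ++ Symb.comma :: i =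
      encodeWord u ++ Symb.plus :: (encodeConsts l ++ Symb.comma :: i) by simp [encodeConsts]]
    refine ((runs_word u).trans ((runs_read _).trans (h.trans ((runs_mark e).trans ih)))).congr
      ?_ ?_
    · simp only [encodeConsts, List.flatMap_cons, List.length_append, List.length_cons,
        List.length_nil, mul_add]
      nlinarith [Nat.zero_le (B * (encodeWord u).length)]
    · simp [encodeConsts, put_put]

/-- The tag pending at the end stays open; the handling of `=` or `;` completes it to the term with
variable `2`. -/
theorem runs_terms (B e : ℕ) (he : e ≤ B) (l : List (BWord × ℕ)) (a : Symb) :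
    Runs ((2 * B + 4) * (encodeTerms l).length + 1) (.read true r)
      (store (encodeTerms l ++ a :: i) o (List.replicate e one) []
        (put O (.terms r) (encodeWord (tag e))))
      (.handle true r a) (store i o (List.replicate e one) []
        (put (put O (.terms r) (encodeTerms (l.map fun t => (tag e * code t.1, 2 * t.2 + 1)) ++
          encodeWord (tag e)))
          (.names r) (encodeNames (l.map fun t => (tag e * code t.1, 2 * t.2 + 1))))) := by
  induction l generalizing O with
  | nil =>
    refine (runs_read _).congr (by omega) ?_
    simp [put_nil, encodeTerms, encodeNames]
  | cons u l ih =>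
    obtain ⟨u, X⟩ := u
    have h1 : ∀ i O, Runs 1 (.handle true r .dot) (store i o (List.replicate e one) [] O)
        (.read true r) (store i o (List.replicate e one) []
          (put (put O (.terms r) [.dot, .bit true]) (.names r) [.dot, .bit true])) :=
      fun i O => Runs.of_step fun v => ⟨v, by simp [program, handleCode]⟩
    have h2 : ∀ i O, Runs 1 (.handle true r .plus) (store i o (List.replicate e one) [] O)
        (.mark true r) (store i o (List.replicate e one) []
          (put (put O (.terms r) [.plus]) (.names r) [.plus])) :=
      fun i O => Runs.of_step fun v => ⟨v, by simp [program, handleCode]⟩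
    -- Writes to different buffers commute, so the interleaved writes to `terms` and `names` can be
    -- collected.
    have hO : put (put (put (put (put (put (put (put (put O (.terms r) (encodeWord (tag e)))
        (wordBuf true r) (encodeWord (code u))) (.terms r) [.dot, .bit true])
        (.names r) [.dot, .bit true])
        (.terms r) ((Computability.encodeNat X).map Symb.bit))
        (.names r) ((Computability.encodeNat X).map Symb.bit))
        (.terms r) [.plus]) (.names r) [.plus]) (wordBuf true r) (encodeWord (tag e)) =
        put (put (put O (.terms r) (encodeTerms [(tag e * code u, 2 * X + 1)]))
          (.names r) (encodeNames [(tag e * code u, 2 * X + 1)]))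
          (.terms r) (encodeWord (tag e)) := by
      funext b
      cases b <;> simp [put, wordBuf, encodeTerms, encodeNames, encodeTerm, encodeName,
        encodeWord_mul, encodeNat_two_mul_add_one] <;> grind
    rw [show encodeTerms ((u, X) :: l) ++ a :: i = encodeWord u ++ Symb.dot ::
      ((Computability.encodeNat X).map Symb.bit ++ Symb.plus :: (encodeTerms l ++ a :: i)) by
      simp [encodeTerms, encodeTerm]]
    refine ((runs_word u).trans ((runs_read _).trans ((h1 _ _).trans ((runs_bits _).trans
      ((runs_read _).trans ((h2 _ _).trans (((runs_mark e).congr le_rfl (congrArg _ hO)).trans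
      ih))))))).congr ?_ ?_
    · simp only [encodeTerms, encodeTerm, List.flatMap_cons, List.length_append, List.length_cons,
        List.length_nil, List.length_map, mul_add]
      nlinarith [Nat.zero_le (B * (encodeWord u).length),
        Nat.zero_le (B * (Computability.encodeNat X).length)]
    · congr 1
      funext b
      cases b <;> simp [put, encodeTerms, encodeNames] <;> grind

theorem runs_side (B e : ℕ) (he : e ≤ B) (s : Side) (a : Symb) :
    Runs ((2 * B + 4) * (encodeSide s).length + 1) (.read false r)
      (store (encodeSide s ++ a :: i) o (List.replicate e one) []
        (put O (.consts r) (encodeWord (tag e))))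
      (.handle true r a) (store i o (List.replicate e one) []
        (put (put (put O (.consts r) (encodeConsts (codedConsts e s)))
          (.terms r) (encodeTerms (s.terms.map fun t => (tag e * code t.1, 2 * t.2 + 1)) ++
            encodeWord (tag e)))
          (.names r) (encodeNames (s.terms.map fun t => (tag e * code t.1, 2 * t.2 + 1))))) := by
  have hs : encodeSide s = encodeConsts s.consts ++ [Symb.comma] ++ encodeTerms s.terms := by
    simp [encodeSide, encodeConsts, encodeTerms]
  rw [show encodeSide s ++ a :: i =
    encodeConsts s.consts ++ Symb.comma :: (encodeTerms s.terms ++ a :: i) by simp [hs]]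
  refine ((runs_consts B e he s.consts).trans (runs_terms B e he s.terms a)).congr ?_ rfl
  rw [hs, List.length_append (bs := encodeTerms _), mul_add, add_assoc]

theorem runs_equals (e : ℕ) :
    Runs (2 * e + 3) (.handle true r .equals) (store i o (List.replicate e one) [] O)
      (.read false true) (store i o (List.replicate e one) []
        (put (put (put O (.terms r) (encodeName 2 ++ [.plus])) (.names r) (encodeName 2 ++ [.plus]))
          (.consts true) (encodeWord (tag e)))) := by
  have h : Runs 1 (.handle true r .equals) (store i o (List.replicate e one) [] O)
      (.mark false true) (store i o (List.replicate e one) []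
        (put (put O (.terms r) (encodeName 2 ++ [.plus])) (.names r)
          (encodeName 2 ++ [.plus]))) :=
    Runs.of_step fun v => ⟨v, by simp [program, handleCode]⟩
  exact (h.trans (runs_mark e)).congr (by omega) rfl

theorem runs_semicolon (e : ℕ) :
    Runs (2 * e + 5) (.handle true r .semicolon) (store i o (List.replicate e one) [] O)
      (.read false false) (store i o (List.replicate (e + 1) one) []
        (put (put (put O (.terms r) (encodeName 2 ++ [.plus])) (.names r) (encodeName 2 ++ [.plus]))
          (.consts false) (encodeWord (tag (e + 1))))) := by
  have h : Runs 1 (.handle true r .semicolon) (store i o (List.replicate e one) [] O)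
      (.mark false false) (store i o (List.replicate (e + 1) one) []
        (put (put O (.terms r) (encodeName 2 ++ [.plus])) (.names r)
          (encodeName 2 ++ [.plus]))) :=
    Runs.of_step fun v => ⟨v, by simp [program, handleCode, List.replicate_succ]⟩
  exact (h.trans (runs_mark (e + 1))).congr (by omega) rfl

/-- The contribution of the equations of `S`, numbered from `k`, to the buffers. -/
def systemOutput (k : ℕ) (S : LangSystem) : Buf → List Symb
  | .consts r => encodeConsts ((S.zipIdx k).flatMap fun p => codedConsts p.2 (p.1.side r))
  | .terms r => encodeTerms ((S.zipIdx k).flatMap fun p => codedTerms p.2 (p.1.side r))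
  | .names r => encodeNames ((S.zipIdx k).flatMap fun p => codedTerms p.2 (p.1.side r))

/-- The bound `e + 1 ≤ B` leaves room for copying the next tag at the semicolon, which costs `2(e +
1) + 2` steps. -/
theorem runs_equation (B e : ℕ) (he : e + 1 ≤ B) (E : Equation) :
    Runs ((2 * B + 4) * (encodeEquation E ++ [Symb.semicolon]).length) (.read false false)
      (store (encodeEquation E ++ Symb.semicolon :: i) o (List.replicate e one) []
        (put O (.consts false) (encodeWord (tag e))))
      (.read false false) (store i o (List.replicate (e + 1) one) []
        (put (fun b => O b ++ systemOutput e [E] b)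
          (.consts false) (encodeWord (tag (e + 1))))) := by
  rw [show encodeEquation E ++ Symb.semicolon :: i =
    encodeSide E.lhs ++ Symb.equals :: (encodeSide E.rhs ++ Symb.semicolon :: i) by
    simp [encodeEquation]]
  refine ((runs_side B e (by omega) E.lhs .equals).trans ((runs_equals e).trans
    ((runs_side B e (by omega) E.rhs .semicolon).trans (runs_semicolon e)))).congr ?_ ?_
  · simp only [encodeEquation, List.length_append, List.length_cons, List.length_nil, mul_add]
    omega
  · congr 1
    funext b
    rcases b with r | r | r <;> cases r <;>
      simp [put, systemOutput, Equation.side, codedConsts, codedTerms, encodeConsts,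
        encodeTerms, encodeNames, encodeTerm, encodeName]

theorem runs_system (B k : ℕ) (S : LangSystem) (hB : k + S.length ≤ B) :
    Runs ((2 * B + 4) * (encodeSystem S).length) (.read false false)
      (store (encodeSystem S) o (List.replicate k one) []
        (put O (.consts false) (encodeWord (tag k))))
      (.read false false) (store [] o (List.replicate (k + S.length) one) []
        (put (fun b => O b ++ systemOutput k S b)
          (.consts false) (encodeWord (tag (k + S.length))))) := by
  induction S generalizing k O with
  | nil =>
    refine (Runs.refl _ _ _).congr le_rfl ?_
    congr 2
    funext b
    cases b <;> simp [systemOutput, encodeConsts, encodeTerms, encodeNames]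
  | cons E S ih =>
    rw [List.length_cons] at hB
    rw [show encodeSystem (E :: S) = encodeEquation E ++ Symb.semicolon :: encodeSystem S by
      simp [encodeSystem]]
    refine ((runs_equation B k (by omega) E).trans (ih (k + 1) (by omega))).congr ?_ ?_
    · simp only [List.length_append, List.length_cons, List.length_nil, mul_add]
      omega
    · rw [List.length_cons, Nat.add_right_comm, Nat.add_assoc]
      congr 2
      funext b
      cases b <;> simp [systemOutput, encodeConsts, encodeTerms, encodeNames]

/-- After the last semicolon the left buffer of constants holds a tag that no equation uses. The
same tag is written on the right, which is the origin of the trailing constant in `mergedSide`. -/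
theorem runs_finish (e : ℕ) :
    Runs (e + 1) .finish (store [] [] (List.replicate e one) [] O)
      (.drain (.names true)) (store [] controlSuffix [] []
        (put (put O (.consts true) (encodeWord (tag e) ++ [.plus])) (.consts false) [.plus])) := by
  induction e generalizing O with
  | zero => exact Runs.of_step fun _ => ⟨none, by simp [program, store, encodeWord, tag]⟩
  | succ e ih =>
    have h : Runs 1 .finish (store [] [] (List.replicate (e + 1) one) [] O) .finish
        (store [] [] (List.replicate e one) [] (put O (.consts true) [one])) :=
      Runs.of_step fun _ => ⟨some one, by simp [program, store, List.replicate_succ]⟩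
    refine (h.trans ih).congr (by omega) ?_
    rw [put_put]
    rfl

/-- The contents of the buffers after the input has been read. -/
def collected (S : LangSystem) : Buf → List Symb
  | .consts r => encodeConsts (mergedSide S r).consts
  | .terms r => encodeTerms (mergedSide S r).terms
  | .names r => encodeNames (mergedSide S r).terms

theorem length_le_length_encodeSystem (S : LangSystem) : S.length ≤ (encodeSystem S).length := by
  induction S with
  | nil => simp
  | cons E S ih =>
    simp only [encodeSystem, List.flatMap_cons, List.length_append, List.length_cons,
      List.length_nil] at ih ⊢
    omega

theorem runs_collect (S : LangSystem) :
    Runs ((2 * (encodeSystem S).length + 6) * ((encodeSystem S).length + 2)) .start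
      (store (encodeSystem S) [] [] [] fun _ => [])
      (.drain (.names true)) (store [] controlSuffix [] [] (collected S)) := by
  have h : Runs 1 .start (store (encodeSystem S) [] [] [] fun _ => []) (.mark false false)
      (store (encodeSystem S) [] (List.replicate 1 one) [] fun
        | .consts _ => encodeConsts baseConsts
        | .terms r => encodeTerms (baseTerms r)
        | .names r => encodeNames (baseTerms r)) := by
    refine Runs.of_step fun v => ⟨v, ?_⟩
    simp only [program, stepAux_pushes_buf, stepAux_pushes_counter, TM2.stepAux]
    congr 2
    funext b
    rcases b with r | r | r <;> cases r <;> simp [put]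
  have hread : ∀ c O, Runs 1 (.read false false) (store [] [] c [] O) .finish
      (store [] [] c [] O) :=
    fun c O => Runs.of_step fun _ => ⟨none, by simp [program, store]⟩
  have hlen := length_le_length_encodeSystem S
  refine (h.trans ((runs_mark 1).trans ((runs_system ((encodeSystem S).length + 1) 1 S
    (by omega)).trans ((hread _ _).trans (runs_finish _))))).congr ?_ ?_
  · nlinarith
  · congr 1
    funext b
    rcases b with r | r | r <;> cases r <;>
      simp [put, systemOutput, collected, mergedSide, encodeConsts, encodeTerms, encodeNames,
        add_comm]

theorem runs_drain (b : Buf) :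
    Runs (O b).length (.drain b) (store [] o [] [] O)
      (.drain b) (store [] (O b ++ o) [] [] (Function.update O b [])) := by
  induction hw : O b using List.reverseRecOn generalizing O o with
  | nil => exact (Runs.refl _ _ _).congr le_rfl (by rw [← hw, Function.update_eq_self]; rw [hw]; rfl)
  | append_singleton w a ih =>
    have h : Runs 1 (.drain b) (store [] o [] [] O) (.drain b)
        (store [] (a :: o) [] [] (Function.update O b w)) :=
      Runs.of_step fun _ => ⟨some a, by simp [program, store, hw]⟩
    refine (h.trans (ih (O := Function.update O b w) (by simp))).congr (by simp; omega) ?_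
    simp

theorem runs_drained {b b' : Buf} {w : List Symb} (hb : O b = [])
    (h : drained b = pushes .output w.reverse (.goto fun _ => .drain b')) :
    Runs 1 (.drain b) (store [] o [] [] O) (.drain b') (store [] (w ++ o) [] [] O) :=
  have hO : Function.update O b [] = O := by rw [← hb, Function.update_eq_self]
  Runs.of_step fun _ => ⟨none, by simp [program, store, hb, h, hO]⟩

theorem runs_output :
    Runs ((O (.names true)).length + (O (.names false)).length + (O (.terms true)).length +
        (O (.consts true)).length + (O (.terms false)).length + (O (.consts false)).length + 5)
      (.drain (.names true)) (store [] o [] [] O)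
      (.drain (.consts false)) (store [] (O (.consts false) ++ [Symb.comma] ++
        O (.terms false) ++ [Symb.equals] ++ O (.consts true) ++ [Symb.comma] ++
        O (.terms true) ++ (Symb.semicolon :: controlPrefix) ++
        O (.names false) ++ O (.names true) ++ o) [] [] fun _ => []) := by
  have h : ∀ {b b' : Buf} {w : List Symb} (o : List Symb) (O : Buf → List Symb),
      drained b = pushes .output w.reverse (.goto fun _ => .drain b') →
      Runs ((O b).length + 1) (.drain b) (store [] o [] [] O) (.drain b')
        (store [] (w ++ (O b ++ o)) [] [] (Function.update O b [])) :=
    fun o O h => (runs_drain _).trans (runs_drained (Function.update_self ..) h)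
  refine ((h (b := .names true) (w := []) _ _ rfl).trans
    ((h (b := .names false) (w := Symb.semicolon :: controlPrefix) _ _ rfl).trans
    ((h (b := .terms true) (w := [Symb.comma]) _ _ rfl).trans
    ((h (b := .consts true) (w := [Symb.equals]) _ _ rfl).trans
    ((h (b := .terms false) (w := [Symb.comma]) _ _ rfl).trans
    (runs_drain (.consts false))))))).congr ?_ ?_
  · simp [Function.update]
    omega
  · congr 1
    · simp [Function.update]
    · funext b
      rcases b with r | r | r <;> cases r <;> simp [Function.update]

end Phases

/-! ### Correctness of the output and polynomial running time -/

theorem encodeSystem_reduction (S : LangSystem) :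
    encodeSystem (reduction S) = collected S (.consts false) ++ [Symb.comma] ++
      collected S (.terms false) ++ [Symb.equals] ++ collected S (.consts true) ++ [Symb.comma] ++
      collected S (.terms true) ++ (Symb.semicolon :: controlPrefix) ++
      collected S (.names false) ++ collected S (.names true) ++ controlSuffix := by
  simp [encodeSystem, reduction, encodeEquation, encodeSide, collected, controlEquation,
    controlPrefix, controlSuffix, encodeConsts, encodeTerms, encodeNames, encodeTerm, encodeName,
    encodeWord_one, List.flatMap_map]

theorem exists_halts : ∃ d : ℕ, ∀ S : LangSystem,
    ∃ k ≤ (6 * d + 1) * ((2 * (encodeSystem S).length + 6) * ((encodeSystem S).length + 2)) +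
        6 * (encodeSystem S).length + 6,
      (flip bind (TM2.step program))^[k]
        (some ⟨some .start, none, store (encodeSystem S) [] [] [] fun _ => []⟩) =
      some ⟨none, none, store [] (encodeSystem (reduction S)) [] [] fun _ => []⟩ := by
  obtain ⟨d, hd⟩ := Finset.exists_le (Finset.univ.image fun l => pushCount (program l))
  replace hd : ∀ l, pushCount (program l) ≤ d := fun l =>
    hd _ (Finset.mem_image_of_mem _ (Finset.mem_univ l))
  refine ⟨d, fun S => ?_⟩
  obtain ⟨j, hj, v, hv⟩ := runs_collect S none
  obtain ⟨k, hk, v', hv'⟩ := runs_output (o := controlSuffix) (O := collected S) v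
  have hspace := stackSpace_iterate hd hv
  have hinput : stackSpace (store (encodeSystem S) [] [] [] fun _ => []) =
      (encodeSystem S).length := by
    refine (Finset.sum_eq_single Stk.input (fun k _ hk => ?_) (by simp)).trans rfl
    cases k <;> simp_all [store]
  have hbuf : ∀ b, (collected S b).length ≤
      stackSpace (store [] controlSuffix [] [] (collected S)) := by
    intro b
    refine le_trans ?_ (Finset.single_le_sum (fun _ _ => Nat.zero_le _)
      (Finset.mem_univ (Stk.buf b)))
    simp [store]
  simp only [hinput] at hspace
  -- The extra step pops the now empty last buffer. This halts the machine and resets its internal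
  -- state to `none`, as a halting configuration requires. Each of the six buffers has length at
  -- most the input length plus `j * d`.
  refine ⟨1 + (k + j), ?_, ?_⟩
  · have h1 := hbuf (.names true)
    have h2 := hbuf (.names false)
    have h3 := hbuf (.terms true)
    have h4 := hbuf (.consts true)
    have h5 := hbuf (.terms false)
    have h6 := hbuf (.consts false)
    have h7 := Nat.mul_le_mul_right d hj
    rw [add_mul, one_mul, mul_assoc, mul_comm d]
    omega
  · rw [Function.iterate_add_apply, Function.iterate_add_apply, hv, hv', encodeSystem_reduction]
    simp [flip, program, store, drained]

/-- The machine computing the reduction. -/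
def reductionMachine : FinTM2 where
  K := Stk
  k₀ := .input
  k₁ := .output
  Γ _ := Symb
  Λ := Lbl
  main := .start
  σ := Option Symb
  initialState := none
  m := program

theorem initList_reductionMachine (w : List Symb) :
    initList reductionMachine w = ⟨some Lbl.start, none, store w [] [] [] fun _ => []⟩ := by
  unfold initList
  congr 1
  funext k
  cases k <;> rfl

theorem haltList_reductionMachine (w : List Symb) :
    haltList reductionMachine w = ⟨none, none, store [] w [] [] fun _ => []⟩ := by
  unfold haltList
  congr 1
  funext k
  cases k <;> rfl

theorem polyTime_reduction : PolyTime reduction := by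
  obtain ⟨d, hd⟩ := exists_halts
  have hout : ∀ S, Nonempty (TM2OutputsInTime reductionMachine (encodeSystem S)
      (some (encodeSystem (reduction S)))
      ((((6 * d + 1 : ℕ) : Polynomial ℕ) * ((2 * Polynomial.X + 6) * (Polynomial.X + 2)) +
        6 * Polynomial.X + 6 : Polynomial ℕ).eval (encodeSystem S).length)) := by
    intro S
    obtain ⟨k, hk, h⟩ := hd S
    refine ⟨⟨⟨k, ?_⟩, hk.trans (le_of_eq (by simp))⟩⟩
    exact (congrArg _ (congrArg some (initList_reductionMachine _))).trans
      (h.trans (congrArg some (haltList_reductionMachine _).symm))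
  have hid : ∀ w : List Symb, w.map (Equiv.refl Symb).invFun = w := List.map_id
  exact ⟨{
    tm := reductionMachine
    inputAlphabet := Equiv.refl Symb
    outputAlphabet := Equiv.refl Symb
    time := _
    outputsFun := fun S => cast (by erw [hid, hid]) (hout S).some }⟩

end LangEq

/-! ### The main theorem -/

theorem proposition3 :
    ∃ f : LangEq.LangSystem → LangEq.LangSystem, LangEq.PolyTime f ∧
      ∀ S : LangEq.LangSystem,
        ∃ (L K : List LangEq.BWord) (I J : List (LangEq.BWord × ℕ)) (Z : ℕ),
          -- the syntactic form of the output
          f S = [⟨⟨L, I⟩, ⟨K, J⟩⟩, LangEq.controlEquation Z ((I ++ J).map Prod.snd)] ∧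
          (∀ t ∈ I ++ J, t.1 ≠ 1 ∧ t.2 ≠ Z) ∧
          -- sat-equivalence, over `B*` and over `A*`
          (LangEq.SolvableB S ↔ LangEq.SolvableB (f S)) ∧
          (LangEq.SolvableA S ↔ LangEq.SolvableA (f S)) ∧
          -- a solvable output has a solution in nonempty prefix-closed subsets of `B*`, which is
          -- a solution over the group as well
          (LangEq.SolvableA (f S) →
            ∃ σ : ℕ → Set LangEq.BWord,
              LangEq.IsSolution (MonoidHom.id LangEq.BWord) (f S) σ ∧
              (∀ X, (σ X).Nonempty ∧ LangEq.PrefixClosed (σ X)) ∧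
              LangEq.IsSolution LangEq.toFG (f S) (fun X => LangEq.toFG '' σ X)) ∧
          -- solvability of the output over the group
          (LangEq.SolvableFG (f S) ↔ LangEq.SolvableB S) ∧
          -- the second equation forces solutions into suffix-closed subsets of `B*`
          (∀ σ : ℕ → Set (FreeMonoid LangEq.SignedLetter), (∀ X, (σ X).Finite) →
            (LangEq.controlEquation Z ((I ++ J).map Prod.snd)).Holds LangEq.toAWord σ →
            LangEq.SuffixControlled LangEq.toAWord σ Z ((I ++ J).map Prod.snd)) ∧
          (∀ σ : ℕ → Set (FreeGroup LangEq.Letter), (∀ X, (σ X).Finite) →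
            (LangEq.controlEquation Z ((I ++ J).map Prod.snd)).Holds LangEq.toFG σ →
            LangEq.SuffixControlled LangEq.toFG σ Z ((I ++ J).map Prod.snd)) := by
  refine ⟨LangEq.reduction, LangEq.polyTime_reduction, fun S => ⟨_, _, _, _, _, rfl, ?_, ?_⟩⟩
  · intro t ht
    obtain ht | ht := List.mem_append.1 ht
    exacts [LangEq.mergedSide_terms ht, LangEq.mergedSide_terms ht]
  have hA := (LangEq.solvableA_iff_solvableB S).trans
    ((LangEq.solvableB_reduction_iff S).trans (LangEq.solvableA_iff_solvableB _).symm)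
  refine ⟨LangEq.solvableB_reduction_iff S, hA, fun h => ?_, ⟨fun h => ?_, fun h => ?_⟩, ?_, ?_⟩
  · obtain ⟨σ, hσ, hσ'⟩ := LangEq.exists_prefixClosed_solution
      ((LangEq.solvableA_iff_solvableB S).1 (hA.2 h))
    exact ⟨σ, hσ, hσ', hσ.image⟩
  · exact LangEq.solvableB_of_reduction
      (LangEq.solvableB_of_controlled LangEq.toFG_injective (fun _ _ _ => mul_right_cancel) h)
  · obtain ⟨σ, hσ⟩ := (LangEq.solvableB_reduction_iff S).1 h
    exact ⟨_, hσ.image⟩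
  · exact fun σ hfin h => LangEq.suffixControlled_of_holds LangEq.toAWord_injective
      (fun _ _ _ => mul_right_cancel) (hfin _) h
  · exact fun σ hfin h => LangEq.suffixControlled_of_holds LangEq.toFG_injective
      (fun _ _ _ => mul_right_cancel) (hfin _) h
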